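/- Let $p$ be a prime and let $n,k$ be integers with $n\ge 2$ and $0<k\le n-1$. Let $PG(n,p)$ be the $n$-dimensional projective space over $\mathbb{F}_p$; its points are the $1$-dimensional linear subspaces of $\mathbb{F}_p^{\,n+1}$, and a $d$-space of $PG(n,p)$ is a subspace of projective dimension $d$ (coming from a linear subspace of dimension $d+1$). The incidence vector of a subspace $S$ is the vector $\chi_S$, indexed by the points of $PG(n,p)$, with entry $1\in\mathbb{F}_p$ at the points of $S$ and entry $0$ elsewhere. Let $C_k(n,p)$ be the $\mathbb{F}_p$-linear span of the incidence vectors of all $k$-spaces of $PG(n,p)$, and let $$C_k(n,p)^\perp=\Big\{v \;:\; \sum_{P} v_P c_P=0\ \text{ for all } c\in C_k(n,p)\Big\}$$ be its dual code, where $v$ ranges over all vectors with entries in $\mathbb{F}_p$ indexed by the points of $PG(n,p)$. The weight of a vector is the number of its non-zero entries, and the minimum weight of a code is the smallest weight of a non-zero codeword. Then the minimum weight of $C_k(n,p)^\perp$ equals $2p^{n-k}$. Moreover, a vector $c$ is a codeword of $C_k(n,p)^\perp$ of weight $2p^{n-k}$ if and only if $c=a(\chi_S-\chi_T)$ for some non-zero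 $a\in\mathbb{F}_p$ and some $(n-k)$-spaces $S,T$ of $PG(n,p)$ whose intersection is an $(n-k-1)$-space. -/

import Mathlib

open scoped LinearAlgebra.Projectivization Matrix

noncomputable section

namespace ProjCode

/-- The points of `PG(n, q)`, where `F` is the field with `q` elements: the one-dimensional
subspaces of `F ^ (n + 1)`. -/
abbrev Point (n : ℕ) (F : Type) [Field F] : Type := ℙ F (Fin (n + 1) → F)

/-- The (projective) subspaces of `PG(n, q)`. -/
abbrev Space (n : ℕ) (F : Type) [Field F] : Type :=
  Projectivization.Subspace F (Fin (n + 1) → F)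

/-- `S` is a `d`-space: its projective dimension is `d`, that is, the underlying linear subspace
of `F ^ (n + 1)` has dimension `d + 1`. -/
def IsSpace {n : ℕ} {F : Type} [Field F] (d : ℕ) (S : Space n F) : Prop :=
  Module.finrank F S.submodule = d + 1

instance instFintypePoint (n : ℕ) (F : Type) [Field F] [Finite F] : Fintype (Point n F) :=
  Fintype.ofFinite _

open Classical in
/-- The incidence vector, with entries in `𝔽_p`, of a subspace of `PG(n, q)`. -/
def incVec (p : ℕ) {n : ℕ} {F : Type} [Field F] (S : Space n F) : Point n F → ZMod p :=
  fun P => if P ∈ S then 1 else 0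

/-- The incidence matrix of points (columns) and `k`-spaces (rows) of `PG(n, q)`. -/
def incMatrix (p k n : ℕ) (F : Type) [Field F] :
    Matrix {S : Space n F // IsSpace k S} (Point n F) (ZMod p) :=
  Matrix.of fun S => incVec p S.1

/-- The code `C_k(n, q)`: the `𝔽_p`-span of the rows of the incidence matrix of points and
`k`-spaces (for `F` the field with `q` elements, `q` a power of `p`). -/
def code (p k n : ℕ) (F : Type) [Field F] : Submodule (ZMod p) (Point n F → ZMod p) :=
  Submodule.span (ZMod p) (Set.range (incMatrix p k n F).row)

/-- The dual of a linear code: all vectors whose scalar product with every codeword is zero. -/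
def dual {p : ℕ} {ι : Type} [Fintype ι] (C : Submodule (ZMod p) (ι → ZMod p)) :
    Submodule (ZMod p) (ι → ZMod p) where
  carrier := {v | ∀ c ∈ C, v ⬝ᵥ c = 0}
  add_mem' := by
    intro a b ha hb c hc
    rw [add_dotProduct, ha c hc, hb c hc, add_zero]
  zero_mem' := fun c _ => zero_dotProduct c
  smul_mem' := by
    intro r a ha c hc
    rw [smul_dotProduct, ha c hc, smul_zero]

/-- The weight of a vector: the number of its non-zero positions. -/
def wt {p : ℕ} {ι : Type} [Fintype ι] (c : ι → ZMod p) : ℕ := hammingNorm c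

/-- `d` is the minimum weight of the code `C`: the least weight of a non-zero codeword. -/
def IsMinWeight {p : ℕ} {ι : Type} [Fintype ι] (C : Submodule (ZMod p) (ι → ZMod p))
    (d : ℕ) : Prop :=
  IsLeast {w : ℕ | ∃ c ∈ C, c ≠ 0 ∧ wt c = w} d

end ProjCode

end

/-! Extend a vector on points by zero at the origin and constantly on non-zero multiples. It lies in
the dual code exactly when the extension `f` sums to zero over every `(k+1)`-dimensional linear
subspace, and the support of `f` has `p - 1` times as many elements as that of the vector.

If `f` vanishes on some linear hyperplane, restricting it to a parallel hyperplane gives an affine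
function whose sums over `k`-flats vanish, with one support point per projective point. If `f`
vanishes on no hyperplane, induction inside each hyperplane and averaging show that the weight
exceeds the bound strictly (`IsPointFunction.bound`).

The affine problem (`flat_bound`) is reduced to sums over lines by projecting along a direction in
which a line meets the support in one point; this lowers `k` by one and does not enlarge the
support. In the equality case two such projections in sufficiently different directions pin down the
support. Characteristic 2 needs a separate argument because there the two signs coincide.

For lines, one works with moments: if all line moments up to order `z` vanish and `f` is zero on `w`
parallel hyperplanes, then on every other parallel hyperplane the line moments vanish up to order `z
+ w` (`vertical_moments`). Induction on the dimension and `p(z+2) ≤ (p-w)(z+w+2)` give the bound.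
For `z = 0` equality forces `w = 0` or `w = p - 2`. The second case yields two parallel hyperplanes,
and a count over a pencil shows that the first cannot hold in every direction
(`isHyperplaneDifference_of_card_supp`).

Conversely, a `(k+1)`-dimensional and an `(n-k+1)`-dimensional subspace always meet in a positive
power of `p` vectors, so differences of `(n-k)`-spaces lie in the dual code. -/

noncomputable section

namespace ProjCode

open Finset Module Polynomial
open scoped Classical

/-! ### Moments of functions on the line and the plane over `𝔽_p`. -/

section Moments

variable {p : ℕ} [Fact p.Prime]

/-- A polynomial function of degree less than `p` on `𝔽_p` that vanishes has zero coefficients. -/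
theorem coeff_eq_zero_of_sum_pow_eq_zero (c : ℕ → ZMod p) {N : ℕ} (hN : N ≤ p)
    (h : ∀ u : ZMod p, ∑ j ∈ range N, c j * u ^ j = 0) {j : ℕ} (hj : j < N) : c j = 0 := by
  set P : (ZMod p)[X] := ∑ j ∈ range N, C (c j) * X ^ j with hP
  have hcoeff : ∀ i < N, P.coeff i = c i := by
    intro i hi
    simp [hP, finsetSum_coeff, coeff_C_mul, coeff_X_pow, hi]
  have hdeg : P.degree < N := by
    refine (degree_sum_le _ _).trans_lt ?_
    rw [Finset.sup_lt_iff (by exact WithBot.bot_lt_coe N)]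
    intro i hi
    refine (degree_C_mul_X_pow_le _ _).trans_lt ?_
    exact_mod_cast mem_range.1 hi
  have hP0 : P = 0 := by
    by_contra hne
    have hnat : P.natDegree < N := (natDegree_lt_iff_degree_lt hne).2 hdeg
    refine hne (eq_zero_of_natDegree_lt_card_of_eval_eq_zero P (f := (id : ZMod p → ZMod p))
      Function.injective_id (fun u => ?_) ?_)
    · simpa [hP, eval_finsetSum] using h u
    · rw [ZMod.card]; omega
  rw [← hcoeff j hj, hP0, coeff_zero]

theorem sum_eval_mul_eq_zero {z : ℕ} {g : ZMod p → ZMod p}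
    (hg : ∀ l ≤ z, ∑ t, t ^ l * g t = 0) {h : (ZMod p)[X]} (hh : h.natDegree ≤ z) :
    ∑ t, h.eval t * g t = 0 := by
  simp_rw [eval_eq_sum_range' (Nat.lt_succ_of_le hh), sum_mul]
  rw [sum_comm]
  refine sum_eq_zero fun i hi => ?_
  simp_rw [mul_assoc]
  rw [← mul_sum, hg i (Nat.le_of_lt_succ (mem_range.1 hi)), mul_zero]

/-- A non-zero function on `𝔽_p` whose moments up to order `z` vanish has at least `z + 2`
non-zero values. -/
theorem le_card_support_of_moments {z : ℕ} {g : ZMod p → ZMod p}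
    (hg : ∀ l ≤ z, ∑ t, t ^ l * g t = 0) {t₀ : ZMod p} (ht₀ : g t₀ ≠ 0) :
    z + 2 ≤ #{t | g t ≠ 0} := by
  by_contra hlt
  set A : Finset (ZMod p) := ({t | g t ≠ 0} : Finset (ZMod p)).erase t₀ with hA
  have hmem : t₀ ∈ ({t | g t ≠ 0} : Finset (ZMod p)) := by simpa using ht₀
  have hcard : #A + 1 = #{t | g t ≠ 0} := card_erase_add_one hmem
  -- If the support had at most `z + 1` points, this polynomial would have degree at most `z` and
  -- isolate the value at `t₀`.
  have h := sum_eval_mul_eq_zero hg (h := ∏ t ∈ A, (X - C t))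
    (by rw [natDegree_prod_of_monic _ _ fun t _ => monic_X_sub_C t]; simp; omega)
  rw [sum_eq_single t₀] at h
  · rcases mul_eq_zero.1 h with h | h
    · rw [eval_prod, prod_eq_zero_iff] at h
      obtain ⟨t, ht, h⟩ := h
      simp only [eval_sub, eval_X, eval_C, sub_eq_zero] at h
      rw [← h] at ht
      simp [hA] at ht
    · exact ht₀ h
  · intro t _ htne
    by_cases hgt : g t = 0
    · simp [hgt]
    · rw [eval_prod, prod_eq_zero (i := t), zero_mul]
      · simp [hA, htne, hgt]
      · simp
  · simp

/-- If the moments of order at most `z` along all non-vertical lines of the plane vanish, so do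
all planar moments of degree at most `p - 1 + z`. -/
theorem planar_moments {z : ℕ} {g : ZMod p → ZMod p → ZMod p}
    (hg : ∀ l ≤ z, ∀ u v : ZMod p, ∑ s, s ^ l * g s (u * s + v) = 0) {i m : ℕ}
    (hm : m ≤ p - 1) (him : i + m ≤ p - 1 + z) :
    ∑ s, ∑ y, s ^ i * y ^ m * g s y = 0 := by
  have hp : 0 < p := (Fact.out : p.Prime).pos
  have key : ∀ l ≤ z, ∀ j M : ℕ, j ≤ M → M ≤ p - 1 →
      ∑ s, ∑ y, s ^ (l + j) * y ^ (M - j) * g s y = 0 := by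
    intro l hl j M hj hM
    -- Weighting the lines of slope `u` by `v ^ M` and substituting `v = y - u * s` gives a
    -- polynomial in `u` of degree at most `M < p`. It vanishes identically, so each coefficient
    -- does, and the binomials are units because `M < p`.
    have hexp : ∀ u : ZMod p, ∑ j ∈ range (M + 1),
        ((-1) ^ j * (M.choose j : ZMod p) *
          ∑ s, ∑ y, s ^ (l + j) * y ^ (M - j) * g s y) * u ^ j = 0 := by
      intro u
      have h1 : ∑ v : ZMod p, v ^ M * ∑ s, s ^ l * g s (u * s + v) = 0 :=
        sum_eq_zero fun v _ => by rw [hg l hl, mul_zero]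
      have h2 : ∑ v : ZMod p, v ^ M * ∑ s, s ^ l * g s (u * s + v) =
          ∑ s, ∑ y, s ^ l * (-(u * s) + y) ^ M * g s y := by
        simp_rw [mul_sum]
        rw [sum_comm]
        refine sum_congr rfl fun s _ => ?_
        refine Fintype.sum_equiv (Equiv.addLeft (u * s)) _ _ fun v => ?_
        simp only [Equiv.coe_addLeft]
        ring_nf
      rw [← h1, h2]
      simp_rw [add_pow, mul_sum, sum_mul]
      rw [sum_comm]
      refine sum_congr rfl fun s _ => ?_
      rw [sum_comm]
      refine sum_congr rfl fun y _ => sum_congr rfl fun j _ => ?_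
      rw [pow_add, neg_pow (u * s), mul_pow]
      ring
    have h := coeff_eq_zero_of_sum_pow_eq_zero _ (by omega) hexp (j := j) (by omega)
    have hc : (M.choose j : ZMod p) ≠ 0 := by
      rw [Ne, ZMod.natCast_eq_zero_iff]
      intro hdvd
      have hf : p ∣ M.factorial := by
        rw [← Nat.choose_mul_factorial_mul_factorial hj, mul_assoc]
        exact hdvd.mul_right _
      rw [(Fact.out : p.Prime).dvd_factorial] at hf
      omega
    simpa [hc] using h
  by_cases hiz : i ≤ z
  · simpa using key i hiz 0 m (Nat.zero_le _) hm
  · have h := key z le_rfl (i - z) (m + (i - z)) (by omega) (by omega)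
    rw [show z + (i - z) = i by omega, show m + (i - z) - (i - z) = m by omega] at h
    exact h

/-- If `g` vanishes on the vertical lines over `Z`, then its restriction to every vertical line has
`#Z` more vanishing moments. -/
theorem vertical_moments {z : ℕ} {g : ZMod p → ZMod p → ZMod p}
    (hg : ∀ l ≤ z, ∀ u v : ZMod p, ∑ s, s ^ l * g s (u * s + v) = 0) (Z : Finset (ZMod p))
    (hZ : ∀ s ∈ Z, ∀ y, g s y = 0) {m : ℕ} (hm : m ≤ p - 1) (hmz : m ≤ z + #Z) (s₀ : ZMod p) :
    ∑ y, y ^ m * g s₀ y = 0 := by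
  by_cases hs₀ : s₀ ∈ Z
  · simp [hZ s₀ hs₀]
  -- The polynomial with roots `A` has degree `p - 1 - #Z`, so multiplied by `y ^ m` it stays within
  -- total degree `p - 1 + z`. It kills every vertical line except those over `Z`, where `g` is
  -- zero, and the one over `s₀`.
  set A : Finset (ZMod p) := (insert s₀ Z)ᶜ with hA
  have hAc : #A + (#Z + 1) = p := by
    have := card_compl_add_card (insert s₀ Z)
    rwa [card_insert_of_notMem hs₀, ZMod.card] at this
  set h : (ZMod p)[X] := ∏ t ∈ A, (X - C t) with hh
  have hdeg : h.natDegree = #A := by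
    rw [hh, natDegree_prod_of_monic _ _ fun t _ => monic_X_sub_C t]; simp
  have h0 : ∑ s, h.eval s * ∑ y, y ^ m * g s y = 0 := by
    refine sum_eval_mul_eq_zero (z := #A) (fun l hl => ?_) hdeg.le
    rw [← planar_moments hg (i := l) hm (by omega)]
    simp_rw [mul_sum, mul_assoc]
  rw [sum_eq_single s₀] at h0
  · refine (mul_eq_zero.1 h0).resolve_left fun h1 => ?_
    rw [hh, eval_prod, prod_eq_zero_iff] at h1
    obtain ⟨t, ht, h1⟩ := h1
    simp only [eval_sub, eval_X, eval_C, sub_eq_zero] at h1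
    rw [← h1] at ht
    simp [hA] at ht
  · intro s _ hs
    by_cases hsZ : s ∈ Z
    · simp [hZ s hsZ]
    · rw [hh, eval_prod, prod_eq_zero (i := s), zero_mul]
      · simp [hA, hs, hsZ]
      · simp
  · simp

end Moments

/-! ### The support bound for functions with vanishing line moments. -/

section LineMoments

variable {p : ℕ} [Fact p.Prime] {V : Type*} [AddCommGroup V] [Module (ZMod p) V]

/-- All moments of order at most `z` of `f` along affine lines vanish. -/
def LineMomentsVanish (z : ℕ) (f : V → ZMod p) : Prop :=
  ∀ l ≤ z, ∀ x h : V, h ≠ 0 → ∑ t : ZMod p, t ^ l * f (x + t • h) = 0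

/-- The support of a function. -/
def supp {ι : Type*} [Fintype ι] (f : ι → ZMod p) : Finset ι := {v | f v ≠ 0}

@[simp]
theorem mem_supp {ι : Type*} [Fintype ι] {f : ι → ZMod p} {v : ι} : v ∈ supp f ↔ f v ≠ 0 := by
  simp [supp]

theorem exists_dual_ne_zero {n : ℕ} (hn : finrank (ZMod p) V = n + 1) :
    ∃ π : Dual (ZMod p) V, π ≠ 0 := by
  have : Nontrivial V := nontrivial_of_finrank_pos (R := ZMod p) (by omega)
  obtain ⟨v, hv⟩ := exists_ne (0 : V)
  by_contra! h
  exact hv ((forall_dual_apply_eq_zero_iff (ZMod p) v).1 fun π => by rw [h π]; rfl)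

theorem exists_dual_apply_eq_one {π : Dual (ZMod p) V} (hπ : π ≠ 0) : ∃ e, π e = 1 :=
  LinearMap.surjective hπ 1

theorem finrank_ker_dual [Finite V] {π : Dual (ZMod p) V}
    (hπ : π ≠ 0) {n : ℕ} (hn : finrank (ZMod p) V = n + 1) : finrank (ZMod p) (LinearMap.ker π) = n := by
  have := Dual.finrank_ker_add_one_of_ne_zero hπ
  omega

/-- Each line in the slice spans, together with `e`, a plane in which it is a vertical line;
`vertical_moments` applies there. -/
theorem LineMomentsVanish.slice {z : ℕ} {f : V → ZMod p} (hf : LineMomentsVanish z f)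
    {π : Dual (ZMod p) V} {e : V} (he : π e = 1) {Z : Finset (ZMod p)}
    (hZ : ∀ v, π v ∈ Z → f v = 0) (s : ZMod p) {w : ℕ} (hw : w ≤ p - 1) (hwZ : w ≤ z + #Z) :
    LineMomentsVanish w (fun u : LinearMap.ker π => f (s • e + u)) := by
  intro m hm x h hh
  have hx : π (x : V) = 0 := x.2
  have hπh : π (h : V) = 0 := h.2
  have := vertical_moments (z := z) (g := fun s y => f (x + s • e + y • (h : V))) ?_ Z ?_
    (m := m) (by omega) (by omega) s
  · rw [← this]
    refine sum_congr rfl fun t _ => ?_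
    beta_reduce
    rw [show s • e + ((x + t • h : LinearMap.ker π) : V) = x + s • e + t • (h : V) by
      push_cast; module]
  · intro l hl a b
    rw [← hf l hl (x + b • (h : V)) (e + a • (h : V)) ?_]
    · refine sum_congr rfl fun t _ => ?_
      congr 2
      module
    · intro h0
      have := congrArg π h0
      simp [he, hπh] at this
  · intro t ht y
    refine hZ _ ?_
    simpa [hx, hπh, he] using ht

variable [Fintype V]

theorem card_slice {π : Dual (ZMod p) V} {e : V} (he : π e = 1) (f : V → ZMod p) (s : ZMod p) :
    #{v ∈ supp f | π v = s} = #(supp fun u : LinearMap.ker π => f (s • e + u)) := by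
  symm
  refine card_bij (fun u _ => s • e + u) (fun u hu => ?_) (fun u _ u' _ h => ?_) fun v hv => ?_
  · have : π (u : V) = 0 := u.2
    simp_all
  · simpa using h
  · simp only [mem_filter, mem_supp] at hv
    refine ⟨⟨v - s • e, by simp [he, hv.2]⟩, ?_, ?_⟩
    · simpa using hv.1
    · simp

theorem card_eq_sum_card_level {ι : Type*} (π : ι → ZMod p) (X : Finset ι) :
    #X = ∑ s, #{v ∈ X | π v = s} :=
  card_eq_sum_card_fiberwise (t := univ) (by simp)

/-- The levels of `π` on which `f` vanishes identically. -/
def zeroLevels (f : V → ZMod p) (π : Dual (ZMod p) V) : Finset (ZMod p) :=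
  {s | ∀ v, π v = s → f v = 0}

theorem eq_zero_of_mem_zeroLevels {f : V → ZMod p} {π : Dual (ZMod p) V} {v : V}
    (h : π v ∈ zeroLevels f π) : f v = 0 := by
  simp only [zeroLevels, mem_filter, mem_univ, true_and] at h
  exact h v rfl

/-- A line through `v` transversal to the levels meets each level once and carries at least `z + 2`
support points, all on non-zero levels. -/
theorem card_zeroLevels_le {z : ℕ} {f : V → ZMod p} (hf : LineMomentsVanish z f)
    {π : Dual (ZMod p) V} (hπ : π ≠ 0) {v : V} (hv : f v ≠ 0) :
    #(zeroLevels f π) + z + 2 ≤ p := by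
  obtain ⟨e, he⟩ := exists_dual_apply_eq_one hπ
  have he0 : e ≠ 0 := by rintro rfl; simp at he
  have h1 := le_card_support_of_moments (g := fun t => f (v + t • e)) (t₀ := 0)
    (fun l hl => hf l hl v e he0) (by simpa using hv)
  have h2 : #{t : ZMod p | f (v + t • e) ≠ 0} ≤ #(zeroLevels f π)ᶜ := by
    refine card_le_card_of_injOn (fun t => π v + t) (fun t ht => ?_) (by simp [Set.InjOn])
    simp only [coe_filter, mem_univ, true_and, Set.mem_ofPred_eq] at ht
    rw [mem_coe, mem_compl]
    intro hmem
    refine ht (eq_zero_of_mem_zeroLevels (π := π) ?_)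
    simpa [he] using hmem
  have h3 := card_add_card_compl (zeroLevels f π)
  rw [ZMod.card] at h3
  omega

theorem slice_ne_zero {f : V → ZMod p} {π : Dual (ZMod p) V} {e : V} (he : π e = 1)
    {s : ZMod p} (hs : s ∉ zeroLevels f π) : ∃ u : LinearMap.ker π, f (s • e + u) ≠ 0 := by
  simp only [zeroLevels, mem_filter, mem_univ, true_and, not_forall] at hs
  obtain ⟨v, hv, hfv⟩ := hs
  exact ⟨⟨v - s • e, by simp [he, hv]⟩, by simpa using hfv⟩

theorem sum_levels_ge {f : V → ZMod p} {π : Dual (ZMod p) V} {b : ℕ}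
    (hb : ∀ s ∉ zeroLevels f π, b ≤ p * #{v ∈ supp f | π v = s}) :
    (p - #(zeroLevels f π)) * b ≤ p * #(supp f) := by
  rw [card_eq_sum_card_level π, mul_sum]
  have h3 := card_add_card_compl (zeroLevels f π)
  rw [ZMod.card] at h3
  calc (p - #(zeroLevels f π)) * b = ∑ s ∈ (zeroLevels f π)ᶜ, b := by
        rw [sum_const, smul_eq_mul]; congr 1; omega
    _ ≤ ∑ s ∈ (zeroLevels f π)ᶜ, p * #{v ∈ supp f | π v = s} :=
        sum_le_sum fun s hs => hb s (mem_compl.1 hs)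
    _ ≤ _ := sum_le_sum_of_subset (subset_univ _)

/-- The difference of the two sides is `w(p - w - z - 2)`, whose zeros govern the equality case. -/
theorem slice_arith {p z w : ℕ} (h : w + z + 2 ≤ p) : p * (z + 2) ≤ (p - w) * (z + w + 2) := by
  obtain ⟨r, rfl⟩ := Nat.exists_eq_add_of_le h
  rw [show w + z + 2 + r - w = z + 2 + r by omega]
  nlinarith [Nat.zero_le (w * r)]

/-- A Schwartz-Zippel bound for functions whose line moments vanish. -/
theorem LineMomentsVanish.le_card_support {n : ℕ} : ∀ {V : Type*} [AddCommGroup V]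
    [Module (ZMod p) V] [Fintype V] {z : ℕ} {f : V → ZMod p}, finrank (ZMod p) V = n →
    LineMomentsVanish z f → z + 2 ≤ p → (∃ v, f v ≠ 0) →
    (z + 2) * p ^ n ≤ p * #(supp f) := by
  induction n with
  | zero =>
    intro V _ _ _ z f hV hf hz ⟨v, hv⟩
    have : 0 < #(supp f) := card_pos.2 ⟨v, by simpa using hv⟩
    nlinarith
  | succ n ih =>
    intro V _ _ _ z f hV hf hz ⟨v, hv⟩
    obtain ⟨π, hπ⟩ := exists_dual_ne_zero hV
    obtain ⟨e, he⟩ := exists_dual_apply_eq_one hπ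
    have hw := card_zeroLevels_le hf hπ hv
    have hs := sum_levels_ge (f := f) (π := π) (b := (z + #(zeroLevels f π) + 2) * p ^ n)
      fun s hs => by
        rw [card_slice he]
        exact ih (finrank_ker_dual hπ hV) (hf.slice he (fun _ => eq_zero_of_mem_zeroLevels) s
          (by omega) le_rfl) (by omega) (slice_ne_zero he hs)
    refine le_trans ?_ hs
    rw [← mul_assoc, pow_succ, mul_comm (p ^ n) p, ← mul_assoc, mul_comm (z + 2)]
    exact Nat.mul_le_mul_right _ (slice_arith hw)

theorem LineMomentsVanish.level_bound {n z : ℕ} {f : V → ZMod p} (hV : finrank (ZMod p) V = n + 1)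
    (hf : LineMomentsVanish z f) {π : Dual (ZMod p) V} (hπ : π ≠ 0) {v : V} (hv : f v ≠ 0)
    {s : ZMod p} (hs : s ∉ zeroLevels f π) :
    (z + #(zeroLevels f π) + 2) * p ^ n ≤ p * #{v ∈ supp f | π v = s} := by
  obtain ⟨e, he⟩ := exists_dual_apply_eq_one hπ
  have hw := card_zeroLevels_le hf hπ hv
  rw [card_slice he]
  exact (hf.slice he (fun _ => eq_zero_of_mem_zeroLevels) s
    (by omega) le_rfl).le_card_support (finrank_ker_dual hπ hV) (by omega) (slice_ne_zero he hs)

end LineMoments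

/-! ### Equality in the line case: two parallel hyperplanes. -/

section ParallelHyperplanes

variable {p : ℕ} [Fact p.Prime]

/-- `f` is `a` times the difference of the indicators of two parallel hyperplanes. -/
def IsHyperplaneDifference {V : Type*} [AddCommGroup V] [Module (ZMod p) V] (f : V → ZMod p) :
    Prop :=
  ∃ π : Dual (ZMod p) V, π ≠ 0 ∧ ∃ t₁ t₂ a : ZMod p, t₁ ≠ t₂ ∧ a ≠ 0 ∧
    (∀ v, π v = t₁ → f v = a) ∧ (∀ v, π v = t₂ → f v = -a) ∧
    ∀ v, π v ≠ t₁ → π v ≠ t₂ → f v = 0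

variable {V : Type*} [AddCommGroup V] [Module (ZMod p) V]

/-- The hyperplanes of the pencil through the flat `π = 0, σ = t` partition a set that avoids
this flat. -/
theorem card_eq_sum_pencil (X : Finset V) (π σ : Dual (ZMod p) V) (t : ZMod p)
    (h : ∀ v ∈ X, π v = 0 → σ v ≠ t) :
    #X = #{v ∈ X | π v = 0} + ∑ c : ZMod p, #{v ∈ X | (σ + c • π) v = t} := by
  rw [← card_filter_add_card_filter_not (s := X) (fun v => π v = 0)]
  congr 1
  rw [card_eq_sum_card_level (fun v => (t - σ v) / π v)]
  refine sum_congr rfl fun c _ => ?_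
  congr 1
  ext v
  simp only [mem_filter, LinearMap.add_apply, LinearMap.smul_apply, smul_eq_mul]
  constructor
  · rintro ⟨⟨hv, h0⟩, hc⟩
    refine ⟨hv, ?_⟩
    rw [← hc]
    field_simp
    ring
  · rintro ⟨hv, hc⟩
    have h0 : π v ≠ 0 := by
      intro h0
      exact h v hv h0 (by simpa [h0] using hc)
    refine ⟨⟨hv, h0⟩, ?_⟩
    rw [div_eq_iff h0]
    linear_combination -hc

variable [Fintype V]

theorem card_eq_pow {n : ℕ} (hV : finrank (ZMod p) V = n) : Fintype.card V = p ^ n := by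
  rw [Module.card_eq_pow_finrank (K := ZMod p), ZMod.card, hV]

/-- With `p - 2` empty levels, the slice bound on each of the two remaining levels equals the size
of the level, so both are full. A line joining them has just two support points, so their values are
opposite. -/
theorem isHyperplaneDifference_of_card_zeroLevels {n : ℕ} {f : V → ZMod p}
    (hV : finrank (ZMod p) V = n + 1) (hf : LineMomentsVanish 0 f) {π : Dual (ZMod p) V}
    (hπ : π ≠ 0) {v : V} (hv : f v ≠ 0) (hw : #(zeroLevels f π) + 2 = p) :
    IsHyperplaneDifference f := by
  have hcompl : #(zeroLevels f π)ᶜ = 2 := by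
    have := card_add_card_compl (zeroLevels f π)
    rw [ZMod.card] at this
    omega
  obtain ⟨t₁, t₂, hne, ht⟩ := card_eq_two.1 hcompl
  have hmem : ∀ t, t ∉ zeroLevels f π ↔ t = t₁ ∨ t = t₂ := by
    intro t
    rw [← mem_compl, ht]; simp
  obtain ⟨e, he⟩ := exists_dual_apply_eq_one hπ
  have hp : 0 < p := (Fact.out : p.Prime).pos
  have hfull : ∀ s ∉ zeroLevels f π, ∀ v, π v = s → f v ≠ 0 := by
    intro s hs v hv'
    have h1 := hf.level_bound hV hπ hv hs
    rw [card_slice he, show 0 + #(zeroLevels f π) + 2 = p by omega] at h1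
    have h2 := Nat.le_of_mul_le_mul_left h1 hp
    have h3 : supp (fun u : LinearMap.ker π => f (s • e + u)) = univ := by
      refine eq_univ_of_card _ (le_antisymm (card_le_univ _) ?_)
      rw [card_eq_pow (finrank_ker_dual hπ hV)]
      exact h2
    have h4 := mem_univ (⟨v - s • e, by simp [he, hv']⟩ : LinearMap.ker π)
    rw [← h3] at h4
    simpa using h4
  have hopp : ∀ x y, π x = t₁ → π y = t₂ → f x = - f y := by
    intro x y hx hy
    have h := hf 0 le_rfl x (y - x) (by
      intro h0
      rw [sub_eq_zero] at h0
      exact hne (by rw [← hx, ← hy, h0]))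
    rw [sum_eq_add (0 : ZMod p) 1 zero_ne_one ?_ (by simp) (by simp)] at h
    · simpa [add_eq_zero_iff_eq_neg] using h
    · intro t _ ht01
      have : f (x + t • (y - x)) = 0 := by
        refine eq_zero_of_mem_zeroLevels (π := π) ?_
        by_contra hcon
        have hd : t₂ - t₁ ≠ 0 := sub_ne_zero.2 hne.symm
        simp only [map_add, map_smul, map_sub, hx, hy, smul_eq_mul] at hcon
        rcases (hmem _).1 hcon with h1 | h1
        · exact ht01.1 (by simpa [hd] using h1)
        · refine ht01.2 (mul_right_cancel₀ hd ?_)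
          linear_combination h1
      simp [this]
  have hy : π (t₂ • e) = t₂ := by simp [he]
  have hx : π (t₁ • e) = t₁ := by simp [he]
  refine ⟨π, hπ, t₁, t₂, f (t₁ • e), hne, hfull t₁ ((hmem _).2 (Or.inl rfl)) _ hx, fun v hv => ?_,
    fun v hv => ?_, fun v h1 h2 => ?_⟩
  · rw [hopp _ _ hv hy, hopp _ _ hx hy]
  · rw [hopp _ _ hx hv, neg_neg]
  · refine eq_zero_of_mem_zeroLevels (π := π) ?_
    by_contra hcon
    rcases (hmem _).1 hcon with h | h
    exacts [h1 h, h2 h]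

/-- Equality in `slice_arith` with `z = 0` means that `w = 0` or `w = p - 2`; if `w = 0`, every
level attains its lower bound. -/
theorem card_zeroLevels_of_card_supp {n : ℕ} {f : V → ZMod p}
    (hV : finrank (ZMod p) V = n + 1) (hf : LineMomentsVanish 0 f) (hX : #(supp f) = 2 * p ^ n)
    {π : Dual (ZMod p) V} (hπ : π ≠ 0) {v : V} (hv : f v ≠ 0) :
    #(zeroLevels f π) + 2 = p ∨ ∀ s, p * #{v ∈ supp f | π v = s} = 2 * p ^ n := by
  have hp : 0 < p := (Fact.out : p.Prime).pos
  have hle := card_zeroLevels_le hf hπ hv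
  have hsum := sum_levels_ge (f := f) (π := π) fun s hs => hf.level_bound hV hπ hv hs
  rw [hX, ← mul_assoc, ← mul_assoc, zero_add] at hsum
  have h1 := Nat.le_of_mul_le_mul_right hsum (by positivity)
  obtain ⟨r, hr⟩ := Nat.exists_eq_add_of_le hle
  have h2 : #(zeroLevels f π) * r = 0 := by
    rw [show p - #(zeroLevels f π) = r + 2 by omega] at h1
    nlinarith
  rcases mul_eq_zero.1 h2 with h0 | h0
  · right
    have hge : ∀ s ∈ (univ : Finset (ZMod p)), 2 * p ^ n ≤ p * #{v ∈ supp f | π v = s} := by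
      intro s _
      have := hf.level_bound hV hπ hv (s := s) (by rw [card_eq_zero.1 h0]; simp)
      rwa [h0] at this
    have heq : ∑ s : ZMod p, 2 * p ^ n = ∑ s, p * #{v ∈ supp f | π v = s} := by
      rw [← mul_sum (f := fun s => #{v ∈ supp f | π v = s}), ← card_eq_sum_card_level, hX,
        sum_const, card_univ, ZMod.card, smul_eq_mul]
    intro s
    exact ((sum_eq_sum_iff_of_le hge).1 heq s (mem_univ s)).symm
  · left; omega

theorem isHyperplaneDifference_of_card_supp {n : ℕ} : ∀ {V : Type*} [AddCommGroup V]
    [Module (ZMod p) V] [Fintype V] {f : V → ZMod p}, finrank (ZMod p) V = n + 1 →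
    LineMomentsVanish 0 f → #(supp f) = 2 * p ^ n → IsHyperplaneDifference f := by
  have hp : 0 < p := (Fact.out : p.Prime).pos
  have hp2 : 2 ≤ p := (Fact.out : p.Prime).two_le
  induction n with
  | zero =>
    intro V _ _ _ f hV hf hX
    obtain ⟨v, hv⟩ : (supp f).Nonempty := card_pos.1 (by rw [hX]; positivity)
    rw [mem_supp] at hv
    obtain ⟨π, hπ⟩ := exists_dual_ne_zero hV
    rcases card_zeroLevels_of_card_supp hV hf hX hπ hv with h | h
    · exact isHyperplaneDifference_of_card_zeroLevels hV hf hπ hv h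
    -- In dimension one, equidistribution of two points forces `p = 2`, where `w = 0` and `w = p -
    -- 2` coincide.
    · have h2 : p ∣ 2 := ⟨_, by simpa using (h 0).symm⟩
      have h3 := Nat.le_of_dvd (by norm_num) h2
      have h4 := card_zeroLevels_le hf hπ hv
      exact isHyperplaneDifference_of_card_zeroLevels hV hf hπ hv (by omega)
  | succ n ih =>
    intro V _ _ _ f hV hf hX
    obtain ⟨v, hv⟩ : (supp f).Nonempty := card_pos.1 (by rw [hX]; positivity)
    rw [mem_supp] at hv
    by_cases hex : ∃ π : Dual (ZMod p) V, π ≠ 0 ∧ #(zeroLevels f π) + 2 = p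
    · obtain ⟨π, hπ, h⟩ := hex
      exact isHyperplaneDifference_of_card_zeroLevels hV hf hπ hv h
    exfalso
    have hlev : ∀ π : Dual (ZMod p) V, π ≠ 0 → ∀ s, #{v ∈ supp f | π v = s} = 2 * p ^ n := by
      intro π hπ s
      have h := (card_zeroLevels_of_card_supp hV hf hX hπ hv).resolve_left
        fun h => hex ⟨π, hπ, h⟩
      refine Nat.eq_of_mul_eq_mul_left hp ((h s).trans ?_)
      ring
    obtain ⟨π, hπ⟩ := exists_dual_ne_zero hV
    obtain ⟨e, he⟩ := exists_dual_apply_eq_one hπ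
    have hp3 : 3 ≤ p := by
      by_contra hlt
      have h4 := card_zeroLevels_le hf hπ hv
      exact hex ⟨π, hπ, by omega⟩
    have hslice := hlev π hπ 0
    rw [card_slice he] at hslice
    obtain ⟨π', hπ', t₁, t₂, -, -, -, -, -, h0⟩ := ih (finrank_ker_dual hπ hV)
      (hf.slice he (fun _ => eq_zero_of_mem_zeroLevels) 0 (Nat.zero_le _) (Nat.zero_le _)) hslice
    -- As `p ≥ 3`, some level of `π'` misses the support. The `p + 1` hyperplanes through this empty
    -- flat would each hold `2 * p ^ n` support points, giving more than `2 * p ^ (n + 1)` in all.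
    obtain ⟨t, ht⟩ : ∃ t : ZMod p, t ∉ ({t₁, t₂} : Finset (ZMod p)) := by
      by_contra! hall
      have h1 := card_le_card (fun t _ => hall t : (univ : Finset (ZMod p)) ⊆ {t₁, t₂})
      rw [card_univ, ZMod.card] at h1
      have := h1.trans card_le_two
      omega
    simp only [mem_insert, mem_singleton, not_or] at ht
    obtain ⟨σ, hσ⟩ := LinearMap.exists_extend π'
    have hσ' : ∀ u : LinearMap.ker π, σ (u : V) = π' u := fun u => by rw [← hσ]; rfl
    have hcard := card_eq_sum_pencil (supp f) π σ t fun v hv hv0 hvt => by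
      have h1 := h0 ⟨v, hv0⟩ (by rw [← hσ']; simpa [hvt] using ht.1)
        (by rw [← hσ']; simpa [hvt] using ht.2)
      simp only [zero_smul, zero_add] at h1
      exact (mem_supp.1 hv) h1
    rw [hlev π hπ, hX, sum_congr rfl fun c _ => hlev (σ + c • π) (fun h => hπ' ?_) t] at hcard
    · rw [sum_const, card_univ, ZMod.card, smul_eq_mul, pow_succ] at hcard
      have : 0 < p ^ n := by positivity
      nlinarith
    · ext u
      have h1 := congrArg (fun τ : Dual (ZMod p) V => τ (u : V)) h
      have h2 : π (u : V) = 0 := u.2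
      simpa [h2, hσ'] using h1

end ParallelHyperplanes

/-! ### Sums over flats and projections along a direction. -/

section FlatSums

variable {p : ℕ} [Fact p.Prime]

/-- `f` is `a` times the difference of the indicators of two parallel `d`-flats. -/
def IsFlatDifference {V : Type*} [AddCommGroup V] [Module (ZMod p) V] (d : ℕ) (f : V → ZMod p) :
    Prop :=
  ∃ (W : Submodule (ZMod p) V) (x y : V) (a : ZMod p), finrank (ZMod p) W = d ∧ y - x ∉ W ∧
    a ≠ 0 ∧ (∀ v, v - x ∈ W → f v = a) ∧ (∀ v, v - y ∈ W → f v = -a) ∧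
    ∀ v, v - x ∉ W → v - y ∉ W → f v = 0

variable {V : Type*} [AddCommGroup V] [Module (ZMod p) V]

theorem sub_mem_left_iff (W : Submodule (ZMod p) V) {x y : V} (h : y - x ∈ W) (v : V) :
    v - y ∈ W ↔ v - x ∈ W := by
  rw [← sub_add_sub_cancel v y x]
  exact (W.add_mem_iff_left h).symm

theorem IsFlatDifference.rebase {d : ℕ} {f : V → ZMod p} (hf : IsFlatDifference d f) {x : V}
    (hx : f x ≠ 0) : ∃ (W : Submodule (ZMod p) V) (y : V), finrank (ZMod p) W = d ∧ y - x ∉ W ∧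
      (∀ v, v - x ∈ W → f v = f x) ∧ (∀ v, v - y ∈ W → f v = -f x) ∧
      ∀ v, v - x ∉ W → v - y ∉ W → f v = 0 := by
  obtain ⟨W, x', y', a, hW, hne, ha, h1, h2, h0⟩ := hf
  by_cases hx1 : x - x' ∈ W
  · have hi := sub_mem_left_iff W hx1
    refine ⟨W, y', hW, ?_, ?_, ?_, ?_⟩
    · rwa [hi]
    · intro v hv; rw [h1 v ((hi v).1 hv), h1 x hx1]
    · intro v hv; rw [h2 v hv, h1 x hx1]
    · intro v hv hv'; exact h0 v (by rwa [← hi]) hv'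
  · by_cases hx2 : x - y' ∈ W
    · have hi := sub_mem_left_iff W hx2
      refine ⟨W, x', hW, ?_, ?_, ?_, ?_⟩
      · rwa [hi, ← W.neg_mem_iff, neg_sub]
      · intro v hv; rw [h2 v ((hi v).1 hv), h2 x hx2]
      · intro v hv; rw [h1 v hv, h2 x hx2, neg_neg]
      · intro v hv hv'; exact h0 v hv' (by rwa [← hi])
    · exact absurd (h0 x hx1 hx2) hx

variable [Fintype V]

/-- The sums of `f` over all `k`-flats vanish. -/
def FlatSumsVanish (k : ℕ) (f : V → ZMod p) : Prop :=
  ∀ W : Submodule (ZMod p) V, finrank (ZMod p) W = k → ∀ x, ∑ v with v - x ∈ W, f v = 0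

theorem FlatSumsVanish.lineMomentsVanish {f : V → ZMod p} (hf : FlatSumsVanish 1 f) :
    LineMomentsVanish 0 f := by
  intro l hl x h hh
  obtain rfl : l = 0 := by omega
  rw [← hf _ (finrank_span_singleton hh) x]
  refine sum_bij (fun t _ => x + t • h) (fun t _ => ?_) (fun t _ t' _ ht => ?_) (fun v hv => ?_)
    fun t _ => by simp
  · simp [Submodule.mem_span_singleton]
  · exact smul_left_injective _ hh (by simpa using ht)
  · simp only [mem_filter, mem_univ, true_and, Submodule.mem_span_singleton] at hv
    obtain ⟨t, ht⟩ := hv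
    exact ⟨t, mem_univ _, by rw [ht]; abel⟩

theorem card_flat {d : ℕ} {W : Submodule (ZMod p) V} (hW : finrank (ZMod p) W = d) (x : V) :
    #{v | v - x ∈ W} = p ^ d := by
  rw [← card_eq_pow hW, ← card_univ]
  symm
  refine card_bij (fun w _ => (w : V) + x) (fun w _ => by simp) (fun w _ w' _ h => by simpa using h)
    fun v hv => ?_
  simp only [mem_filter, mem_univ, true_and] at hv
  exact ⟨⟨v - x, hv⟩, mem_univ _, by simp⟩

/-- A set of the size of a flat containing it fills this flat. -/
theorem eq_flat_of_subset {d : ℕ} {W : Submodule (ZMod p) V} (hW : finrank (ZMod p) W ≤ d)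
    {X : Finset V} (hX : #X = p ^ d) {x : V} (h : ∀ v ∈ X, v - x ∈ W) :
    finrank (ZMod p) W = d ∧ ∀ v, v - x ∈ W → v ∈ X := by
  have hp : 1 < p := (Fact.out : p.Prime).one_lt
  have hsub : X ⊆ ({v | v - x ∈ W} : Finset V) := fun v hv => by simpa using h v hv
  have h1 := card_le_card hsub
  rw [card_flat rfl, hX] at h1
  have h2 := le_antisymm hW ((Nat.pow_le_pow_iff_right hp).1 h1)
  refine ⟨h2, fun v hv => ?_⟩
  have h3 := eq_of_subset_of_card_le hsub (by rw [card_flat h2, hX])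
  rw [h3]; simpa using hv

/-- Counting: `U` excludes at most `p ^ m` vectors, and the multiples of differences from `x` to
other support points at most `(p ^ m - 1)(p - 1)`; together fewer than `p ^ (m + 1)`. -/
theorem exists_tangent_direction {m : ℕ} (hV : finrank (ZMod p) V = m + 1) {f : V → ZMod p} {x : V}
    (hx : f x ≠ 0) (hX : #(supp f) ≤ p ^ m) {U : Submodule (ZMod p) V} (hU : U ≠ ⊤) :
    ∃ r ∉ U, ∀ t : ZMod p, t ≠ 0 → f (x + t • r) = 0 := by
  have hp : 1 < p := (Fact.out : p.Prime).one_lt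
  set B : Finset V := (((supp f).erase x) ×ˢ ((univ : Finset (ZMod p)).erase 0)).image
    (fun q => q.2 • (q.1 - x)) with hB
  have hBc : #B ≤ (#(supp f) - 1) * (p - 1) := by
    refine card_image_le.trans ?_
    rw [card_product, card_erase_of_mem (by simpa using hx), card_erase_of_mem (mem_univ _),
      card_univ, ZMod.card]
  have hUc : #({v | v - 0 ∈ U} : Finset V) ≤ p ^ m := by
    rw [card_flat rfl]
    refine Nat.pow_le_pow_right hp.le ?_
    have := Submodule.finrank_lt (lt_top_iff_ne_top.2 hU).ne
    omega
  obtain ⟨r, hr⟩ : ∃ r, r ∉ ({v | v - 0 ∈ U} : Finset V) ∪ B := by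
    by_contra! hall
    have h1 := card_le_card (fun t _ => hall t : (univ : Finset V) ⊆ _)
    rw [card_univ, card_eq_pow hV] at h1
    have h2 := h1.trans (card_union_le _ _)
    have h3 : (#(supp f) - 1) * (p - 1) ≤ (p ^ m - 1) * (p - 1) := by gcongr
    have h4 : 0 < p ^ m := by positivity
    obtain ⟨q, rfl⟩ := Nat.exists_eq_add_of_lt hp
    obtain ⟨c, hc⟩ := Nat.exists_eq_add_of_lt h4
    simp only [pow_succ] at *
    rw [hc] at h2 h3 hUc
    simp only [Nat.zero_add, Nat.add_sub_cancel] at h3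
    rw [show 1 + q + 1 - 1 = q + 1 by omega] at *
    nlinarith
  simp only [mem_union, not_or, mem_filter, mem_univ, true_and, sub_zero] at hr
  refine ⟨r, hr.1, fun t ht => ?_⟩
  by_contra hf
  refine hr.2 (mem_image.2 ⟨(x + t • r, t⁻¹), ?_, ?_⟩)
  · have hr0 : r ≠ 0 := by rintro rfl; exact hr.1 U.zero_mem
    simp [hf, ht, hr0]
  · simp [smul_smul, ht]

/-- The function on the target of `φ` obtained by summing `f` over the fibres of `φ`. -/
def pushforward {α β : Type*} [Fintype α] (φ : α → β) (f : α → ZMod p) (q : β) : ZMod p :=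
  ∑ v with φ v = q, f v

section Projection

variable {V' : Type*} [AddCommGroup V'] [Module (ZMod p) V'] [Fintype V']
  {φ : V →ₗ[ZMod p] V'}

omit [Fintype V'] in
theorem finrank_comap_of_surjective (hφ : Function.Surjective φ) (W : Submodule (ZMod p) V') :
    finrank (ZMod p) (W.comap φ) = finrank (ZMod p) W + finrank (ZMod p) (LinearMap.ker φ) := by
  rw [← LinearMap.finrank_range_add_finrank_ker (φ.domRestrict (W.comap φ)),
    LinearMap.range_domRestrict, Submodule.map_comap_eq_of_surjective hφ, LinearMap.ker_domRestrict]
  congr 1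
  exact (Submodule.comapSubtypeEquivOfLe (LinearMap.ker_le_comap φ)).finrank_eq

/-- The preimage of a `k`-flat under a projection with one-dimensional kernel is a `(k+1)`-flat. -/
theorem FlatSumsVanish.pushforward {k : ℕ} {f : V → ZMod p} (hf : FlatSumsVanish (k + 1) f)
    (hφ : Function.Surjective φ) (hker : finrank (ZMod p) (LinearMap.ker φ) = 1) :
    FlatSumsVanish k (pushforward φ f) := by
  intro W hW q
  obtain ⟨x, rfl⟩ := hφ q
  rw [← hf (W.comap φ) (by rw [finrank_comap_of_surjective hφ, hW, hker]) x]
  rw [← sum_fiberwise_of_maps_to (t := ({q | q - φ x ∈ W} : Finset V')) (g := φ)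
    (fun v hv => by simpa using hv)]
  refine sum_congr rfl fun q hq => ?_
  refine sum_congr ?_ fun _ _ => rfl
  ext v
  simp only [mem_filter, mem_univ, true_and] at hq ⊢
  constructor
  · rintro rfl
    simpa using hq
  · exact fun h => h.2

theorem supp_pushforward_subset {α β : Type*} [Fintype α] [Fintype β] (φ : α → β)
    (f : α → ZMod p) :
    supp (ProjCode.pushforward φ f) ⊆ (supp f).image φ := by
  intro q hq
  rw [mem_supp] at hq
  obtain ⟨v, hv, hfv⟩ := exists_ne_zero_of_sum_ne_zero hq
  exact mem_image.2 ⟨v, by simpa using hfv, (mem_filter.1 hv).2⟩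

theorem pushforward_apply_of_injOn {α β : Type*} [Fintype α] {φ : α → β} {f : α → ZMod p} {x : α}
    (h : ∀ v, φ v = φ x → f v ≠ 0 → v = x) : ProjCode.pushforward φ f (φ x) = f x := by
  refine sum_eq_single x (fun v hv hne => ?_) (fun h => by simp at h)
  by_contra hfv
  exact hne (h v (mem_filter.1 hv).2 hfv)

/-- The structure of the support of a function whose projection is a difference of flats. -/
theorem flats_of_pushforward {d : ℕ} {f : V → ZMod p} (hφ : Function.Surjective φ)
    (hker : finrank (ZMod p) (LinearMap.ker φ) = 1)
    (hcard : #(supp (ProjCode.pushforward φ f)) = #(supp f))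
    (hd : IsFlatDifference d (ProjCode.pushforward φ f)) {x : V} (hx : f x ≠ 0) :
    ∃ U : Submodule (ZMod p) V, LinearMap.ker φ ≤ U ∧ finrank (ZMod p) U = d + 1 ∧
      ∃ y, f y = -f x ∧ y - x ∉ U ∧
      (∀ v, f v ≠ 0 → (v - x ∈ U ∧ f v = f x) ∨ (v - y ∈ U ∧ f v = -f x)) ∧
      #{v ∈ supp f | v - x ∈ U} = p ^ d ∧ #{v ∈ supp f | v - y ∈ U} = p ^ d := by
  have himg : supp (ProjCode.pushforward φ f) = (supp f).image φ :=
    eq_of_subset_of_card_le (supp_pushforward_subset φ f) (by rw [hcard]; exact card_image_le)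
  -- Equal support sizes make `φ` injective on the support, so values and counts transfer between
  -- `f` and its pushforward.
  have hinj : Set.InjOn φ (supp f) := by
    rw [← card_image_iff, ← himg, hcard]
  have happ : ∀ v, f v ≠ 0 → ProjCode.pushforward φ f (φ v) = f v := fun v hv =>
    pushforward_apply_of_injOn fun w hw hfw => hinj (by simpa using hfw) (by simpa using hv) hw
  obtain ⟨W, y', hW, hne, h1, h2, h0⟩ := hd.rebase (x := φ x) (by rwa [happ x hx])
  rw [happ x hx] at h1 h2
  have hlift : ∀ q, ProjCode.pushforward φ f q ≠ 0 → ∃ v, f v ≠ 0 ∧ φ v = q := by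
    intro q hq
    rw [← mem_supp, himg, mem_image] at hq
    simpa using hq
  obtain ⟨y, hy0, rfl⟩ := hlift y' (by rw [h2 _ (by simp)]; simpa using hx)
  have hy : f y = -f x := by rw [← happ y hy0, h2 _ (by simp)]
  have hcnt : ∀ z : V, (∀ q, q - φ z ∈ W → ProjCode.pushforward φ f q ≠ 0) →
      #{v ∈ supp f | v - z ∈ W.comap φ} = p ^ d := by
    intro z hz
    rw [← card_flat hW (φ z)]
    refine card_bij (fun v _ => φ v) (fun v hv => ?_) (fun v hv w hw h => ?_) fun q hq => ?_
    · simpa using (mem_filter.1 hv).2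
    · exact hinj (mem_filter.1 hv).1 (mem_filter.1 hw).1 h
    · simp only [mem_filter, mem_univ, true_and] at hq
      obtain ⟨v, hv, rfl⟩ := hlift q (hz q hq)
      exact ⟨v, by simpa [hv] using hq, rfl⟩
  refine ⟨W.comap φ, LinearMap.ker_le_comap φ, by rw [finrank_comap_of_surjective hφ, hW, hker],
    y, hy, by simpa using hne, fun v hv => ?_, hcnt x fun q hq => by rwa [h1 q hq],
    hcnt y fun q hq => by rw [h2 q hq]; simpa using hx⟩
  have hv' := happ v hv
  by_cases hvx : φ v - φ x ∈ W
  · exact Or.inl ⟨by simpa using hvx, by rw [← hv', h1 _ hvx]⟩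
  · by_cases hvy : φ v - φ y ∈ W
    · exact Or.inr ⟨by simpa using hvy, by rw [← hv', h2 _ hvy]⟩
    · exact absurd (h0 _ hvx hvy) (by rwa [hv'])

end Projection

end FlatSums

/-! ### The affine theorem for flats of arbitrary dimension. -/

section MinimalWeight

variable {p : ℕ} [Fact p.Prime]

theorem flat_bound_of_line {d : ℕ} {V : Type*} [AddCommGroup V] [Module (ZMod p) V] [Fintype V]
    {f : V → ZMod p} (hV : finrank (ZMod p) V = d + 1) (hf : FlatSumsVanish 1 f)
    (hne : ∃ v, f v ≠ 0) :
    2 * p ^ d ≤ #(supp f) ∧ (#(supp f) = 2 * p ^ d → IsFlatDifference d f) := by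
  have hp : 0 < p := (Fact.out : p.Prime).pos
  have hp2 : 2 ≤ p := (Fact.out : p.Prime).two_le
  refine ⟨?_, fun hX => ?_⟩
  · have := hf.lineMomentsVanish.le_card_support hV (by omega) hne
    refine Nat.le_of_mul_le_mul_left (le_trans (le_of_eq ?_) this) hp
    ring
  · obtain ⟨π, hπ, t₁, t₂, a, hne, ha, h1, h2, h0⟩ :=
      isHyperplaneDifference_of_card_supp hV hf.lineMomentsVanish hX
    obtain ⟨e, he⟩ := exists_dual_apply_eq_one hπ
    have hmem : ∀ v t, v - t • e ∈ LinearMap.ker π ↔ π v = t := by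
      intro v t
      simp [he, sub_eq_zero]
    refine ⟨LinearMap.ker π, t₁ • e, t₂ • e, a, finrank_ker_dual hπ hV, ?_, ha, fun v hv => ?_,
      fun v hv => ?_, fun v hv hv' => ?_⟩
    · rw [hmem]; simpa [he] using hne.symm
    · exact h1 v ((hmem _ _).1 hv)
    · exact h2 v ((hmem _ _).1 hv)
    · exact h0 v (fun h => hv ((hmem _ _).2 h)) (fun h => hv' ((hmem _ _).2 h))

section

variable {V : Type*} [AddCommGroup V] [Module (ZMod p) V] [Fintype V]

/-- As the two values differ, both projections split the support into the same two classes. Each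
class lies in a coset of `U₁ ⊓ U₂`, of dimension at most `d`, and has `p ^ d` points, so it fills
that coset. -/
theorem isFlatDifference_of_two_projections {d : ℕ} {f : V → ZMod p} {x : V}
    (hx : f x ≠ -f x) {U₁ U₂ : Submodule (ZMod p) V} (hU₂ : finrank (ZMod p) U₂ = d + 1)
    (hU : ¬ U₂ ≤ U₁) {y₁ y₂ : V} (hy₁ : f y₁ = -f x) (hyx : y₁ - x ∉ U₁)
    (h₁ : ∀ v, f v ≠ 0 → (v - x ∈ U₁ ∧ f v = f x) ∨ (v - y₁ ∈ U₁ ∧ f v = -f x))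
    (h₂ : ∀ v, f v ≠ 0 → (v - x ∈ U₂ ∧ f v = f x) ∨ (v - y₂ ∈ U₂ ∧ f v = -f x))
    (hc₁ : #{v ∈ supp f | v - x ∈ U₁} = p ^ d) (hc₂ : #{v ∈ supp f | v - y₁ ∈ U₁} = p ^ d) :
    IsFlatDifference d f := by
  have hx0 : f x ≠ 0 := fun h => hx (by simp [h])
  have hdisj : ∀ v, v - x ∈ U₁ → v - y₁ ∉ U₁ := fun v h h' =>
    hyx (by simpa using U₁.sub_mem h h')
  have hW : finrank (ZMod p) (U₁ ⊓ U₂ : Submodule (ZMod p) V) ≤ d := by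
    have : U₁ ⊓ U₂ < U₂ := lt_of_le_of_ne inf_le_right fun h => hU (inf_eq_right.1 h)
    have := Submodule.finrank_lt_finrank_of_lt this
    omega
  have hval : ∀ v, f v ≠ 0 → v - x ∈ U₁ → f v = f x := fun v hv hvx =>
    (h₁ v hv).elim (fun h => h.2) fun h => absurd h.1 (hdisj v hvx)
  have hval' : ∀ v, f v ≠ 0 → v - y₁ ∈ U₁ → f v = -f x := fun v hv hvx =>
    (h₁ v hv).elim (fun h => absurd hvx (hdisj v h.1)) fun h => h.2
  have hy₂ : y₁ - y₂ ∈ U₂ := (h₂ y₁ (by rw [hy₁]; simpa using hx0)).elim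
    (fun h => absurd (h.2.symm.trans hy₁) hx) fun h => h.1
  obtain ⟨hd, hfull⟩ := eq_flat_of_subset hW hc₁ fun v hv => by
    simp only [mem_filter, mem_supp] at hv
    refine ⟨hv.2, (h₂ v hv.1).elim (fun h => h.1) fun h => ?_⟩
    exact absurd ((hval v hv.1 hv.2).symm.trans h.2) hx
  obtain ⟨-, hfull'⟩ := eq_flat_of_subset hW hc₂ fun v hv => by
    simp only [mem_filter, mem_supp] at hv
    refine ⟨hv.2, (h₂ v hv.1).elim (fun h => ?_) fun h => ?_⟩
    · exact absurd (h.2.symm.trans (hval' v hv.1 hv.2)) hx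
    · simpa using U₂.sub_mem h.1 hy₂
  simp only [mem_filter, mem_supp] at hfull hfull'
  refine ⟨U₁ ⊓ U₂, x, y₁, f x, hd, fun h => hyx h.1, hx0, fun v hv => ?_, fun v hv => ?_,
    fun v hv hv' => ?_⟩
  · exact hval v (hfull v hv).1 (hfull v hv).2
  · exact hval' v (hfull' v hv).1 (hfull' v hv).2
  · by_contra hfv
    rcases h₁ v hfv with h | h
    · refine hv ⟨h.1, (h₂ v hfv).elim (fun h => h.1) fun h' => ?_⟩
      exact absurd (h.2.symm.trans h'.2) hx
    · refine hv' ⟨h.1, (h₂ v hfv).elim (fun h' => ?_) fun h' => ?_⟩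
      · exact absurd (h'.2.symm.trans h.2) hx
      · simpa using U₂.sub_mem h'.1 hy₂

end

/-! ### The case `p = 2`. -/

section Binary

variable {V : Type*} [AddCommGroup V] [Module (ZMod 2) V]

theorem zmod_two_eq_one_of_ne_zero {a : ZMod 2} (h : a ≠ 0) : a = 1 := by
  revert a; decide

/-- Over `𝔽_2` a flat splits into two parallel halves, and `1 = -1` makes its indicator their
difference. -/
theorem isFlatDifference_of_supp_eq_flat {d : ℕ} {f : V → ZMod 2} {W : Submodule (ZMod 2) V}
    (hW : finrank (ZMod 2) W = d + 1) {x : V} (h : ∀ v, f v ≠ 0 ↔ v - x ∈ W) :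
    IsFlatDifference d f := by
  have : Module.Finite (ZMod 2) W := finite_of_finrank_pos (by omega)
  have : Finite W := Module.finite_of_finite (ZMod 2)
  have : Fintype W := Fintype.ofFinite W
  obtain ⟨π, hπ⟩ := exists_dual_ne_zero hW
  obtain ⟨e, he⟩ := exists_dual_apply_eq_one hπ
  have hmem : ∀ w : W, (w : V) ∈ (LinearMap.ker π).map W.subtype ↔ π w = 0 := by
    intro w; simp
  have hle : (LinearMap.ker π).map W.subtype ≤ W := Submodule.map_subtype_le _ _
  have hone : ∀ v, v - x ∈ W → f v = 1 := fun v hv => zmod_two_eq_one_of_ne_zero ((h v).2 hv)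
  refine ⟨(LinearMap.ker π).map W.subtype, x, x + e, 1, ?_, ?_, one_ne_zero, fun v hv => ?_,
    fun v hv => ?_, fun v hv hv' => ?_⟩
  · rw [Submodule.finrank_map_subtype_eq, finrank_ker_dual hπ hW]
  · rw [add_sub_cancel_left, hmem, he]; exact one_ne_zero
  · exact hone v (hle hv)
  · rw [show (-1 : ZMod 2) = 1 by decide]
    refine hone v ?_
    have := W.add_mem (hle hv) e.2
    simpa [← sub_sub] using this
  · by_contra hfv
    have hvW := (h v).1 hfv
    have h1 : π ⟨v - x, hvW⟩ ≠ 0 := fun h0 => hv ((hmem ⟨v - x, hvW⟩).2 h0)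
    refine hv' ?_
    have h2 := (hmem (⟨v - x, hvW⟩ - e)).2 (by
      rw [map_sub, he, zmod_two_eq_one_of_ne_zero h1, sub_self])
    simpa [sub_sub] using h2

variable [Fintype V]

theorem FlatSumsVanish.sum_parallelogram {f : V → ZMod 2} (hf : FlatSumsVanish 2 f) (x u v : V) :
    f (x + u + v) + f (x + u) + f (x + v) + f x = 0 := by
  have hdbl : ∀ a : ZMod 2, a + a = 0 := by decide
  have hdblV : ∀ a : V, a + a = 0 := fun a => by
    rw [← two_smul (ZMod 2) a, show (2 : ZMod 2) = 0 by decide, zero_smul]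
  by_cases hu : u = 0
  · subst hu
    simp only [add_zero]
    linear_combination hdbl (f (x + v) + f x)
  by_cases hv : v = 0
  · subst hv
    simp only [add_zero]
    linear_combination hdbl (f (x + u) + f x)
  by_cases huv : u = v
  · subst huv
    rw [add_assoc x u u, hdblV, add_zero]
    linear_combination hdbl (f (x + u) + f x)
  have huv0 : u + v ≠ 0 := fun h => huv (by
    rw [← add_zero u, ← hdblV v, ← add_assoc, h, zero_add])
  have hzo : ∀ a : ZMod 2, a = 0 ∨ a = 1 := by decide
  have hli : LinearIndependent (ZMod 2) ![u, v] := by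
    rw [LinearIndependent.pair_iff]
    intro s t h
    rcases hzo s with rfl | rfl <;> rcases hzo t with rfl | rfl <;> simp_all
  have hrank : finrank (ZMod 2) (Submodule.span (ZMod 2) {u, v}) = 2 := by
    have := finrank_span_eq_card hli
    rwa [Fintype.card_fin, Matrix.range_cons_cons_empty] at this
  rw [← hf _ hrank x]
  have hset : ({w | w - x ∈ Submodule.span (ZMod 2) {u, v}} : Finset V) =
      {x + u + v, x + u, x + v, x} := by
    ext w
    simp only [mem_filter, mem_univ, true_and, Submodule.mem_span_pair, mem_insert, mem_singleton]
    constructor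
    · rintro ⟨a, b, h⟩
      rw [eq_sub_iff_add_eq'] at h
      rcases hzo a with rfl | rfl <;> rcases hzo b with rfl | rfl <;> simp_all [← add_assoc]
    · rintro (rfl | rfl | rfl | rfl)
      · exact ⟨1, 1, by simp [add_assoc]⟩
      · exact ⟨1, 0, by simp⟩
      · exact ⟨0, 1, by simp⟩
      · exact ⟨0, 0, by simp⟩
  rw [hset, sum_insert, sum_insert, sum_insert, sum_singleton]
  · ring
  · simpa using hv
  · simp [hu, huv]
  · simp [hu, hv, add_assoc, huv0]

/-- The parallelogram identity makes `u ↦ f (x + u) + f x` additive, so the support is a coset of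
its kernel. -/
theorem isFlatDifference_of_plane_sums {d : ℕ} {f : V → ZMod 2} (hf : FlatSumsVanish 2 f)
    (hX : #(supp f) = 2 ^ (d + 1)) : IsFlatDifference d f := by
  obtain ⟨x, hx⟩ : (supp f).Nonempty := card_pos.1 (by rw [hX]; positivity)
  rw [mem_supp] at hx
  have hdbl : ∀ a : ZMod 2, a + a = 0 := by decide
  let π : V →+ ZMod 2 :=
    { toFun := fun u => f (x + u) + f x
      map_zero' := by simp [hdbl]
      map_add' := fun u v => by
        have := hf.sum_parallelogram x u v
        rw [← add_assoc]
        linear_combination this - hdbl (f (x + u)) - hdbl (f (x + v)) - hdbl (f x) }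
  have hmem : ∀ v, f v ≠ 0 ↔ v - x ∈ LinearMap.ker (π.toZModLinearMap 2) := by
    intro v
    have h1 : (π.toZModLinearMap 2) (v - x) = f v + f x := by
      change f (x + (v - x)) + f x = _
      rw [add_sub_cancel]
    rw [LinearMap.mem_ker, h1, zmod_two_eq_one_of_ne_zero hx]
    generalize f v = a
    revert a; decide
  refine isFlatDifference_of_supp_eq_flat ?_ hmem
  have h2 : supp f = ({v | v - x ∈ LinearMap.ker (π.toZModLinearMap 2)} : Finset V) := by
    ext v; simpa using hmem v
  rw [h2, card_flat rfl] at hX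
  exact Nat.pow_right_injective le_rfl hX

end Binary

theorem finrank_quotient_span_singleton {V : Type*} [AddCommGroup V] [Module (ZMod p) V] [Finite V]
    {n : ℕ} (hV : finrank (ZMod p) V = n + 1) {r : V} (hr : r ≠ 0) :
    finrank (ZMod p) (V ⧸ Submodule.span (ZMod p) {r}) = n := by
  have h1 := Submodule.finrank_quotient_add_finrank (Submodule.span (ZMod p) {r})
  rw [finrank_span_singleton hr] at h1
  omega

theorem eq_of_mkQ_eq {V : Type*} [AddCommGroup V] [Module (ZMod p) V] {f : V → ZMod p} {x r : V}
    (hr : ∀ t : ZMod p, t ≠ 0 → f (x + t • r) = 0) (v : V)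
    (hv : (Submodule.span (ZMod p) {r}).mkQ v = (Submodule.span (ZMod p) {r}).mkQ x)
    (hfv : f v ≠ 0) : v = x := by
  rw [Submodule.mkQ_apply, Submodule.mkQ_apply, Submodule.Quotient.eq,
    Submodule.mem_span_singleton] at hv
  obtain ⟨t, ht⟩ := hv
  have hv' : v = x + t • r := by rw [ht]; abel
  by_cases h0 : t = 0
  · simpa [h0] using hv'
  · exact absurd (hr t h0) (by rwa [← hv'])

/-- The minimum weight and the words of minimum weight of the dual of the code of `k`-flats of an
affine space. -/
theorem flat_bound {d : ℕ} (k : ℕ) : ∀ {V : Type*} [AddCommGroup V] [Module (ZMod p) V] [Fintype V]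
    {f : V → ZMod p}, finrank (ZMod p) V = d + k + 1 → FlatSumsVanish (k + 1) f →
    (∃ v, f v ≠ 0) →
    2 * p ^ d ≤ #(supp f) ∧ (#(supp f) = 2 * p ^ d → IsFlatDifference d f) := by
  have hp2 : 2 ≤ p := (Fact.out : p.Prime).two_le
  induction k with
  | zero => intro V _ _ _ f hV hf hne; exact flat_bound_of_line hV hf hne
  | succ k ih =>
    intro V _ _ _ f hV hf ⟨x, hx⟩
    by_cases hlt : 2 * p ^ d < #(supp f)
    · exact ⟨hlt.le, fun h => absurd h hlt.ne'⟩
    have hpow : #(supp f) ≤ p ^ (d + k + 1) := by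
      refine (not_lt.1 hlt).trans ?_
      calc 2 * p ^ d ≤ p * p ^ d := by gcongr
        _ = p ^ (d + 1) := by ring
        _ ≤ _ := Nat.pow_le_pow_right (by omega) (by omega)
    have hV' : finrank (ZMod p) V = (d + k + 1) + 1 := hV
    have hproj : ∀ U : Submodule (ZMod p) V, U ≠ ⊤ → 2 * p ^ d ≤ #(supp f) ∧
        (#(supp f) = 2 * p ^ d → ∃ r ∉ U, ∃ U' : Submodule (ZMod p) V, r ∈ U' ∧
          finrank (ZMod p) U' = d + 1 ∧ ∃ y, f y = -f x ∧ y - x ∉ U' ∧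
          (∀ v, f v ≠ 0 → (v - x ∈ U' ∧ f v = f x) ∨ (v - y ∈ U' ∧ f v = -f x)) ∧
          #{v ∈ supp f | v - x ∈ U'} = p ^ d ∧ #{v ∈ supp f | v - y ∈ U'} = p ^ d) := by
      intro U hU
      obtain ⟨r, hrU, hr⟩ := exists_tangent_direction hV' hx hpow hU
      have hr0 : r ≠ 0 := by rintro rfl; exact hrU U.zero_mem
      have : Fintype (V ⧸ Submodule.span (ZMod p) {r}) := Fintype.ofFinite _
      have hsurj := Submodule.mkQ_surjective (Submodule.span (ZMod p) {r})
      have hker : finrank (ZMod p) (LinearMap.ker (Submodule.span (ZMod p) {r}).mkQ) = 1 := by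
        rw [Submodule.ker_mkQ, finrank_span_singleton hr0]
      have hx' := pushforward_apply_of_injOn (eq_of_mkQ_eq hr)
      obtain ⟨h1, h2⟩ := ih (finrank_quotient_span_singleton hV' hr0)
        (hf.pushforward hsurj hker) ⟨_, by rwa [hx']⟩
      have h3 := (card_le_card (supp_pushforward_subset
        (Submodule.span (ZMod p) {r}).mkQ f)).trans card_image_le
      refine ⟨h1.trans h3, fun hX => ?_⟩
      have h4 := le_antisymm h3 (by rwa [hX])
      obtain ⟨U', hle, h5⟩ := flats_of_pushforward hsurj hker h4 (h2 (by rw [h4, hX])) hx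
      refine ⟨r, hrU, U', hle ?_, h5⟩
      rw [Submodule.ker_mkQ]
      exact Submodule.mem_span_singleton_self r
    have htop : ∀ U : Submodule (ZMod p) V, finrank (ZMod p) U < d + k + 2 → U ≠ ⊤ := by
      rintro U hU rfl
      rw [finrank_top] at hU
      omega
    have hbot := htop ⊥ (by rw [finrank_bot]; omega)
    refine ⟨(hproj ⊥ hbot).1, fun hX => ?_⟩
    obtain ⟨-, -, U₁, -, hU₁, y₁, hy₁, hyx, h₁, hc₁, hc₂⟩ := (hproj ⊥ hbot).2 hX
    by_cases hp : p = 2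
    · subst hp
      rw [← pow_succ'] at hX
      -- For plane sums the space `S₁` below could be everything, leaving no direction outside it;
      -- hence the separate argument.
      cases k with
      | zero => exact isFlatDifference_of_plane_sums hf hX
      | succ k =>
        have hsup : ∀ (U : Submodule (ZMod 2) V) (y : V), finrank (ZMod 2) U = d + 1 →
            finrank (ZMod 2) (U ⊔ Submodule.span (ZMod 2) {y - x} : Submodule (ZMod 2) V)
              ≤ d + 2 := by
          intro U y hU
          refine (Submodule.finrank_add_le_finrank_add_finrank _ _).trans ?_
          have := finrank_span_finset_le_card (R := ZMod 2) ({y - x} : Finset V)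
          rw [coe_singleton, card_singleton] at this
          change finrank (ZMod 2) (Submodule.span (ZMod 2) {y - x}) ≤ 1 at this
          omega
        have hin : ∀ (U : Submodule (ZMod 2) V) (y : V), (∀ v, f v ≠ 0 →
            (v - x ∈ U ∧ f v = f x) ∨ (v - y ∈ U ∧ f v = -f x)) → ∀ v, f v ≠ 0 →
            v - x ∈ (U ⊔ Submodule.span (ZMod 2) {y - x} : Submodule (ZMod 2) V) := by
          intro U y h v hv
          rcases h v hv with h | h
          · exact Submodule.mem_sup_left h.1
          · rw [← sub_add_sub_cancel v y x]
            exact Submodule.add_mem_sup h.1 (Submodule.mem_span_singleton_self _)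
        have hS₁ := hsup U₁ y₁ hU₁
        obtain ⟨r, hr, U₂, hrU₂, hU₂, y₂, -, -, h₂, -⟩ :=
          (hproj (U₁ ⊔ Submodule.span (ZMod 2) {y₁ - x}) (htop _ (by omega))).2
            (by rw [hX, pow_succ'])
        have hS₂ := hsup U₂ y₂ hU₂
        set S₁ := U₁ ⊔ Submodule.span (ZMod 2) {y₁ - x}
        set S₂ := U₂ ⊔ Submodule.span (ZMod 2) {y₂ - x}
        -- `S₂` contains the direction `r` outside `S₁`, so the intersection is proper in `S₂`. The
        -- support has `2 ^ (d + 1)` points and therefore fills a coset of it.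
        have hW : finrank (ZMod 2) (S₁ ⊓ S₂ : Submodule (ZMod 2) V) ≤ d + 1 := by
          have : S₁ ⊓ S₂ < S₂ := lt_of_le_of_ne inf_le_right fun h =>
            hr (inf_eq_right.1 h (Submodule.mem_sup_left hrU₂))
          have := Submodule.finrank_lt_finrank_of_lt this
          omega
        have hsub : ∀ v, f v ≠ 0 → v - x ∈ S₁ ⊓ S₂ := fun v hv =>
          ⟨hin U₁ y₁ h₁ v hv, hin U₂ y₂ h₂ v hv⟩
        obtain ⟨hd, hfull⟩ := eq_flat_of_subset hW hX fun v hv => hsub v (mem_supp.1 hv)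
        exact isFlatDifference_of_supp_eq_flat hd fun v =>
          ⟨hsub v, fun hv => mem_supp.1 (hfull v hv)⟩
    · obtain ⟨r, hr, U₂, hrU₂, hU₂, y₂, -, -, h₂, -⟩ := (hproj U₁ (htop _ (by omega))).2 hX
      refine isFlatDifference_of_two_projections (fun h => ?_) hU₂ (fun h => hr (h hrU₂)) hy₁ hyx
        h₁ h₂ hc₁ hc₂
      have h2 : (2 : ZMod p) * f x = 0 := by linear_combination h
      rcases mul_eq_zero.1 h2 with h3 | h3
      · have h4 : ((2 : ℕ) : ZMod p) = 0 := by exact_mod_cast h3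
        rw [ZMod.natCast_eq_zero_iff] at h4
        exact hp ((Nat.prime_dvd_prime_iff_eq Fact.out Nat.prime_two).1 h4)
      · exact hx h3

end MinimalWeight

/-! ### From affine to linear: functions constant on projective points. -/

section Homogeneous

variable {p : ℕ} [Fact p.Prime] {V : Type*} [AddCommGroup V] [Module (ZMod p) V]

/-- `f` is a function on the points of the projective space of `V`, extended to `V` by zero. -/
structure IsPointFunction (f : V → ZMod p) : Prop where
  map_zero : f 0 = 0
  map_smul : ∀ c : ZMod p, c ≠ 0 → ∀ v, f (c • v) = f v

theorem mem_span_singleton_sup {π : Dual (ZMod p) V} {x : V} (hx : π x = 1)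
    {W : Submodule (ZMod p) V} (hW : W ≤ LinearMap.ker π) (v : V) :
    v ∈ Submodule.span (ZMod p) {x} ⊔ W ↔ v - π v • x ∈ W := by
  constructor
  · intro h
    obtain ⟨y, hy, w, hw, rfl⟩ := Submodule.mem_sup.1 h
    obtain ⟨c, rfl⟩ := Submodule.mem_span_singleton.1 hy
    have : π w = 0 := hW hw
    simpa [this, hx] using hw
  · intro h
    rw [← sub_add_cancel v (π v • x)]
    exact Submodule.add_mem _ (Submodule.mem_sup_right h)
      (Submodule.mem_sup_left (Submodule.smul_mem _ _ (Submodule.mem_span_singleton_self x)))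

theorem finrank_span_singleton_sup [Finite V] {π : Dual (ZMod p) V} {x : V} (hx : π x = 1)
    {W : Submodule (ZMod p) V} (hW : W ≤ LinearMap.ker π) :
    finrank (ZMod p) (Submodule.span (ZMod p) {x} ⊔ W : Submodule (ZMod p) V) =
      finrank (ZMod p) W + 1 := by
  have hx0 : x ≠ 0 := by rintro rfl; simp at hx
  have h := Submodule.finrank_sup_add_finrank_inf_eq (Submodule.span (ZMod p) {x}) W
  have hinf : Submodule.span (ZMod p) {x} ⊓ W = ⊥ := by
    rw [eq_bot_iff]
    rintro v ⟨hv, hvW⟩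
    obtain ⟨c, rfl⟩ := Submodule.mem_span_singleton.1 hv
    have : π (c • x) = 0 := hW hvW
    simp only [map_smul, hx, smul_eq_mul, mul_one] at this
    simp [this]
  rw [hinf, finrank_bot, finrank_span_singleton hx0] at h
  omega

theorem IsPointFunction.restrict {f : V → ZMod p} (hf : IsPointFunction f)
    (W : Submodule (ZMod p) V) : IsPointFunction (fun u : W => f u) :=
  ⟨by simp [hf.map_zero], fun c hc v => hf.map_smul c hc v⟩

/-- The non-zero multiples of a vector. -/
def multiples (v : V) : Finset V := ((univ : Finset (ZMod p)).erase 0).image (· • v)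

theorem card_multiples {v : V} (hv : v ≠ 0) : #(multiples (p := p) v) = p - 1 := by
  rw [multiples, card_image_of_injective _ (smul_left_injective _ hv),
    card_erase_of_mem (mem_univ _), card_univ, ZMod.card]

variable [Fintype V]

/-- The sums of `f` over all `k`-dimensional linear subspaces vanish. -/
def SubspaceSumsVanish (k : ℕ) (f : V → ZMod p) : Prop :=
  ∀ W : Submodule (ZMod p) V, finrank (ZMod p) W = k → ∑ v with v ∈ W, f v = 0

theorem cast_card_erase_zero : ((#((univ : Finset (ZMod p)).erase 0) : ℕ) : ZMod p) = -1 := by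
  rw [card_erase_of_mem (mem_univ _), card_univ, ZMod.card,
    Nat.cast_sub (Fact.out : p.Prime).one_lt.le]
  simp

/-- Sum over the linear span of the flat at level one: level zero contributes nothing, and by
homogeneity the other `p - 1` levels contribute equally. The flat sum is thus multiplied by `-1`. -/
theorem IsPointFunction.flatSumsVanish {k : ℕ} {f : V → ZMod p} (hf : IsPointFunction f)
    (hs : SubspaceSumsVanish (k + 1) f) {π : Dual (ZMod p) V} (hπ : ∀ v, π v = 0 → f v = 0)
    {e : V} (he : π e = 1) : FlatSumsVanish k (fun u : LinearMap.ker π => f (e + u)) := by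
  intro W hW x
  have hx : π (e + x) = 1 := by
    have : π (x : V) = 0 := x.2
    rw [map_add, he, this, add_zero]
  have hle : W.map (LinearMap.ker π).subtype ≤ LinearMap.ker π := Submodule.map_subtype_le _ _
  have h := hs _ (by rw [finrank_span_singleton_sup hx hle, Submodule.finrank_map_subtype_eq, hW])
  rw [← sum_fiberwise_of_maps_to (t := univ) (g := π) (fun _ _ => mem_univ _),
    ← add_sum_erase _ _ (mem_univ 0), sum_eq_zero (s := {i ∈ _ | π i = 0}) (fun v hv =>
      hπ v (mem_filter.1 hv).2), zero_add, sum_congr rfl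
      (g := fun _ => ∑ u : LinearMap.ker π with u - x ∈ W, f (e + u)), sum_const, nsmul_eq_mul,
    cast_card_erase_zero] at h
  · simpa using h
  · intro s hs
    have hs0 : s ≠ 0 := ne_of_mem_erase hs
    symm
    refine sum_bij (fun u _ => s • (e + (u : V))) (fun u hu => ?_) (fun u _ u' _ h => ?_)
      (fun v hv => ?_) fun u _ => (hf.map_smul s hs0 _).symm
    · simp only [mem_filter, mem_univ, true_and] at hu ⊢
      have hu0 : π (u : V) = 0 := u.2
      have hps : π (s • (e + (u : V))) = s := by simp [he, hu0]
      refine ⟨?_, hps⟩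
      rw [mem_span_singleton_sup hx hle, hps, ← smul_sub, add_sub_add_left_eq_sub]
      exact Submodule.smul_mem _ _ ⟨_, hu, rfl⟩
    · have := smul_right_injective V hs0 h
      simpa using this
    · simp only [mem_filter, mem_univ, true_and] at hv
      obtain ⟨hv, hvs⟩ := hv
      rw [mem_span_singleton_sup hx hle, hvs] at hv
      obtain ⟨w, hw, hwv⟩ := hv
      refine ⟨x + s⁻¹ • w, ?_, ?_⟩
      · simpa using W.smul_mem s⁻¹ hw
      · have h1 : (w : V) = v - s • (e + (x : V)) := hwv
        push_cast
        rw [h1, smul_add, smul_add, smul_smul, mul_inv_cancel₀ hs0]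
        module

theorem IsPointFunction.card_supp {f : V → ZMod p} (hf : IsPointFunction f) {π : Dual (ZMod p) V}
    (hπ : ∀ v, π v = 0 → f v = 0) {e : V} (he : π e = 1) :
    #(supp f) = (p - 1) * #(supp fun u : LinearMap.ker π => f (e + u)) := by
  have h1 := card_slice he f 1
  simp only [one_smul] at h1
  rw [← h1, card_eq_sum_card_level π, ← add_sum_erase _ _ (mem_univ 0)]
  have h0 : #{v ∈ supp f | π v = 0} = 0 := by
    rw [card_eq_zero, filter_eq_empty_iff]
    intro v hv h
    exact mem_supp.1 hv (hπ v h)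
  rw [h0, zero_add, sum_congr rfl (g := fun _ => #{v ∈ supp f | π v = 1}), sum_const,
    card_erase_of_mem (mem_univ _), card_univ, ZMod.card, smul_eq_mul]
  intro s hs
  have hs0 : s ≠ 0 := ne_of_mem_erase hs
  symm
  refine card_bij (fun v _ => s • v) (fun v hv => ?_) (fun v _ w _ h =>
    smul_right_injective V hs0 h) fun v hv => ⟨s⁻¹ • v, ?_, smul_inv_smul₀ hs0 v⟩
  · simp only [mem_filter, mem_supp] at hv ⊢
    exact ⟨by rw [hf.map_smul s hs0]; exact hv.1, by simp [hv.2]⟩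
  · simp only [mem_filter, mem_supp] at hv ⊢
    exact ⟨by rw [hf.map_smul _ (inv_ne_zero hs0)]; exact hv.1, by simp [hv.2, hs0]⟩

theorem SubspaceSumsVanish.restrict {k : ℕ} {f : V → ZMod p} (hf : SubspaceSumsVanish k f)
    (W : Submodule (ZMod p) V) [Fintype W] : SubspaceSumsVanish k (fun u : W => f u) := by
  intro U hU
  rw [← hf (U.map W.subtype) (by rw [Submodule.finrank_map_subtype_eq, hU])]
  refine sum_bij (fun u _ => u) (fun u hu => ?_) (fun u _ u' _ h => Subtype.ext h)
    (fun v hv => ?_) fun _ _ => rfl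
  · simpa using hu
  · simp only [mem_filter, mem_univ, true_and] at hv
    obtain ⟨u, hu, rfl⟩ := hv
    exact ⟨u, by simpa using hu, rfl⟩

theorem card_restrict (f : V → ZMod p) (W : Submodule (ZMod p) V) [Fintype W] :
    #(supp fun u : W => f u) = #{v ∈ supp f | v ∈ W} := by
  refine card_bij (fun u _ => u) (fun u hu => ?_) (fun u _ u' _ h => Subtype.ext h)
    fun v hv => ?_
  · simpa using hu
  · simp only [mem_filter, mem_supp] at hv
    exact ⟨⟨v, hv.2⟩, by simpa using hv.1, rfl⟩

theorem IsPointFunction.multiples_subset {f : V → ZMod p} (hf : IsPointFunction f) {v : V}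
    (hv : f v ≠ 0) : multiples (p := p) v ⊆ supp f := by
  intro w hw
  simp only [multiples, mem_image, mem_erase, mem_univ, and_true] at hw
  obtain ⟨c, hc, rfl⟩ := hw
  rwa [mem_supp, hf.map_smul c hc]

/-- A single projective point would contribute `-f v ≠ 0` to the sum, so there are at least two. -/
theorem IsPointFunction.le_card_supp_of_sum_eq_zero {f : V → ZMod p} (hf : IsPointFunction f)
    (hsum : ∑ v, f v = 0) {v : V} (hv : f v ≠ 0) : (p - 1) * 2 ≤ #(supp f) := by
  have hne : ∀ w, f w ≠ 0 → w ≠ 0 := by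
    rintro w hw rfl; exact hw hf.map_zero
  have hsub := hf.multiples_subset hv
  obtain ⟨u, hu, hum⟩ : ∃ u, f u ≠ 0 ∧ u ∉ multiples (p := p) v := by
    by_contra! hall
    have h1 : ∑ w ∈ multiples (p := p) v, f w = 0 := by
      rw [← hsum]
      refine sum_subset (subset_univ _) fun w _ hw => ?_
      by_contra hfw
      exact hw (hall w hfw)
    rw [multiples, sum_image (fun a _ b _ h => smul_left_injective _ (hne v hv) h),
      sum_congr rfl (g := fun _ => f v) fun c hc => hf.map_smul c (ne_of_mem_erase hc) v,
      sum_const, nsmul_eq_mul, cast_card_erase_zero] at h1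
    exact hv (by simpa using h1)
  have hdisj : Disjoint (multiples (p := p) v) (multiples (p := p) u) := by
    rw [Finset.disjoint_left]
    intro w hw hw'
    simp only [multiples, mem_image, mem_erase, mem_univ, and_true] at hw hw' hum
    obtain ⟨a, ha, rfl⟩ := hw
    obtain ⟨b, hb, h⟩ := hw'
    refine hum ⟨b⁻¹ * a, by simp [ha, hb], ?_⟩
    rw [mul_smul, ← h, inv_smul_smul₀ hb]
  have h := card_le_card (union_subset hsub (hf.multiples_subset hu))
  rw [card_union_of_disjoint hdisj, card_multiples (hne v hv), card_multiples (hne u hu)] at h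
  omega

theorem sum_card_hyperplane_sections {n : ℕ} (hV : finrank (ZMod p) V = n + 1)
    [Fintype (Dual (ZMod p) V)] {X : Finset V} (hX : ∀ v ∈ X, v ≠ 0) :
    ∑ π : Dual (ZMod p) V, #{v ∈ X | π v = 0} = #X * p ^ n := by
  simp_rw [card_filter]
  rw [sum_comm, ← smul_eq_mul, ← sum_const]
  refine sum_congr rfl fun v hv => ?_
  rw [← card_filter]
  have hev : Dual.eval (ZMod p) V v ≠ 0 := fun h =>
    hX v hv ((forall_dual_apply_eq_zero_iff (ZMod p) v).1 fun π => by
      simpa using congrArg (fun τ => τ π) h)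
  rw [← card_flat (finrank_ker_dual hev (by rw [Subspace.dual_finrank_eq, hV])) 0]
  congr 1
  ext π
  simp

theorem IsPointFunction.bound {k d : ℕ} : ∀ {V : Type*} [AddCommGroup V] [Module (ZMod p) V]
    [Fintype V] {f : V → ZMod p}, IsPointFunction f → finrank (ZMod p) V = d + k + 2 →
    SubspaceSumsVanish (k + 2) f → (∃ v, f v ≠ 0) → (p - 1) * (2 * p ^ d) ≤ #(supp f) ∧
    (0 < d → #(supp f) = (p - 1) * (2 * p ^ d) →
      ∃ π : Dual (ZMod p) V, π ≠ 0 ∧ ∀ v, π v = 0 → f v = 0) := by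
  have hp : 1 < p := (Fact.out : p.Prime).one_lt
  induction d with
  | zero =>
    intro V _ _ _ f hf hV hs ⟨v, hv⟩
    refine ⟨?_, fun h => absurd h (lt_irrefl 0)⟩
    rw [pow_zero, mul_one]
    refine hf.le_card_supp_of_sum_eq_zero ?_ hv
    have := hs ⊤ (by rw [finrank_top, hV]; omega)
    simpa using this
  | succ d ih =>
    intro V _ _ _ f hf hV hs ⟨v, hv⟩
    by_cases hex : ∃ π : Dual (ZMod p) V, π ≠ 0 ∧ ∀ v, π v = 0 → f v = 0
    · refine ⟨?_, fun _ _ => hex⟩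
      obtain ⟨π, hπ, h0⟩ := hex
      obtain ⟨e, he⟩ := exists_dual_apply_eq_one hπ
      rw [hf.card_supp h0 he]
      refine Nat.mul_le_mul_left _ (flat_bound k (finrank_ker_dual hπ (by omega))
        (hf.flatSumsVanish hs h0 he) (by_contra fun hall => hv ?_)).1
      push Not at hall
      have hcard := hf.card_supp h0 he
      rw [card_eq_zero.2 (by ext u; simp [hall u] : supp (fun u : LinearMap.ker π => f (e + u)) = ∅),
        mul_zero, card_eq_zero] at hcard
      by_contra hfv
      have := mem_supp.2 hfv
      rw [hcard] at this
      simp at this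
    -- Write `B` for the inductive bound and `N` for the dimension of `V`. Every hyperplane section
    -- has size at least `B`, so double counting over linear forms gives `#(supp f) * (p ^ (N - 1) -
    -- 1) ≥ (p ^ N - 1) * B`, and `p ^ N - 1 > p * (p ^ (N - 1) - 1)`.
    · have hlt : p * ((p - 1) * (2 * p ^ d)) < #(supp f) := by
        push Not at hex
        by_contra hle
        rw [not_lt] at hle
        have : Finite (Dual (ZMod p) V) := Module.finite_of_finite (ZMod p)
        have : Fintype (Dual (ZMod p) V) := Fintype.ofFinite _
        have hsum := sum_card_hyperplane_sections (p := p) (n := d + k + 2) (by omega) (X := supp f)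
          (by intro w hw; rintro rfl; exact mem_supp.1 hw hf.map_zero)
        rw [← add_sum_erase _ _ (mem_univ 0)] at hsum
        have hge : ∀ π ∈ (univ : Finset (Dual (ZMod p) V)).erase 0,
            (p - 1) * (2 * p ^ d) ≤ #{v ∈ supp f | π v = 0} := by
          intro π hπ
          have hπ0 := ne_of_mem_erase hπ
          obtain ⟨w, hw, hfw⟩ := hex π hπ0
          have := (ih (hf.restrict (LinearMap.ker π)) (finrank_ker_dual hπ0 (by omega))
            (hs.restrict _) ⟨⟨w, hw⟩, hfw⟩).1
          rw [card_restrict] at this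
          simpa using this
        have hge' := sum_le_sum hge
        rw [sum_const, smul_eq_mul, card_erase_of_mem (mem_univ _), card_univ,
          card_eq_pow (p := p) (by rw [Subspace.dual_finrank_eq, hV]; omega :
            finrank (ZMod p) (Dual (ZMod p) V) = (d + k + 2) + 1)] at hge'
        simp only [LinearMap.zero_apply, filter_true] at hsum
        have hB : 0 < (p - 1) * (2 * p ^ d) := by
          have : 0 < p - 1 := by omega
          positivity
        generalize (p - 1) * (2 * p ^ d) = B at *
        have hq : 0 < p ^ (d + k + 2) := by positivity
        obtain ⟨c, hc⟩ := Nat.exists_eq_add_of_lt hq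
        have hq' : p ^ (d + k + 2 + 1) = p * (0 + c + 1) := by rw [pow_succ, hc]; ring
        rw [hq'] at hge'
        rw [hc] at hsum
        have h1 : #(supp f) * c ≤ p * B * c := by gcongr
        obtain ⟨q, rfl⟩ := Nat.exists_eq_add_of_lt hp
        have h2 : (1 + q + 1) * (0 + c + 1) - 1 = (1 + q + 1) * c + q + 1 := by
          rw [Nat.sub_eq_iff_eq_add (Nat.succ_le_of_lt (by positivity))]; ring
        rw [h2] at hge'
        nlinarith
      refine ⟨?_, fun _ h => absurd h (ne_of_gt ?_)⟩
      · refine le_trans (le_of_eq ?_) hlt.le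
        ring
      · refine lt_of_eq_of_lt ?_ hlt
        ring

/-- The functions of minimum weight: differences of two subspaces. -/
theorem IsPointFunction.exists_subspaces {k d : ℕ} {f : V → ZMod p} (hf : IsPointFunction f)
    (hV : finrank (ZMod p) V = d + 1 + k + 2) (hs : SubspaceSumsVanish (k + 2) f)
    (hX : #(supp f) = (p - 1) * (2 * p ^ (d + 1))) :
    ∃ (S T : Submodule (ZMod p) V) (a : ZMod p), a ≠ 0 ∧ finrank (ZMod p) S = d + 2 ∧
      finrank (ZMod p) T = d + 2 ∧ finrank (ZMod p) (S ⊓ T : Submodule (ZMod p) V) = d + 1 ∧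
      ∀ v, f v = a * ((if v ∈ S then 1 else 0) - if v ∈ T then 1 else 0) := by
  have hp : 1 < p := (Fact.out : p.Prime).one_lt
  have hp1 : 0 < p - 1 := by omega
  obtain ⟨v, hv⟩ : (supp f).Nonempty := card_pos.1 (by rw [hX]; positivity)
  rw [mem_supp] at hv
  obtain ⟨π, hπ, h0⟩ := (hf.bound hV hs ⟨v, hv⟩).2 (Nat.succ_pos d) hX
  obtain ⟨e, he⟩ := exists_dual_apply_eq_one hπ
  have hcard := hf.card_supp h0 he
  rw [hX] at hcard
  have hcard' := Nat.eq_of_mul_eq_mul_left hp1 hcard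
  obtain ⟨u, hu⟩ : (supp fun u : LinearMap.ker π => f (e + u)).Nonempty :=
    card_pos.1 (by rw [← hcard']; positivity)
  obtain ⟨W, x, y, a, hW, hxy, ha, h1, h2, h3⟩ := (flat_bound k (finrank_ker_dual hπ hV)
    (hf.flatSumsVanish hs h0 he) ⟨u, by simpa using hu⟩).2 hcard'.symm
  have hmem : ∀ u : LinearMap.ker π, (u : V) ∈ W.map (LinearMap.ker π).subtype ↔ u ∈ W := by
    intro u; simp
  set W' := W.map (LinearMap.ker π).subtype with hW'
  have hle : W' ≤ LinearMap.ker π := Submodule.map_subtype_le _ _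
  have hrank : finrank (ZMod p) W' = d + 1 := by rw [hW', Submodule.finrank_map_subtype_eq, hW]
  have hlvl : ∀ u : LinearMap.ker π, π (e + (u : V)) = 1 := by
    intro u
    have : π (u : V) = 0 := u.2
    rw [map_add, he, this, add_zero]
  have hcone := fun u : LinearMap.ker π => mem_span_singleton_sup (hlvl u) hle
  -- The cones over two distinct parallel flats share only their common direction space: a common
  -- vector off `ker π` would put `y - x` in `W`.
  have hinf : (Submodule.span (ZMod p) {e + (x : V)} ⊔ W') ⊓
      (Submodule.span (ZMod p) {e + (y : V)} ⊔ W') = W' := by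
    refine le_antisymm (fun v hv => ?_) (le_inf le_sup_right le_sup_right)
    rw [Submodule.mem_inf, hcone, hcone] at hv
    have h4 := W'.sub_mem hv.1 hv.2
    rw [sub_sub_sub_cancel_left, ← smul_sub, add_sub_add_left_eq_sub] at h4
    by_cases hc : π v = 0
    · simpa [hc] using hv.1
    · rw [Submodule.smul_mem_iff _ hc] at h4
      exact absurd ((hmem (y - x)).1 (by simpa using h4)) hxy
  refine ⟨Submodule.span (ZMod p) {e + (x : V)} ⊔ W', Submodule.span (ZMod p) {e + (y : V)} ⊔ W', a,
    ha, by rw [finrank_span_singleton_sup (hlvl x) hle, hrank],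
    by rw [finrank_span_singleton_sup (hlvl y) hle, hrank], by rw [hinf, hrank], fun v => ?_⟩
  simp_rw [hcone]
  by_cases hc : π v = 0
  · simp [h0 v hc, hc]
  · have hw : π ((π v)⁻¹ • v - e) = 0 := by simp [he, hc]
    obtain ⟨w, hwv⟩ : ∃ w : LinearMap.ker π, (w : V) = (π v)⁻¹ • v - e := ⟨⟨_, hw⟩, rfl⟩
    have hmem' : ∀ z : LinearMap.ker π, v - π v • (e + (z : V)) ∈ W' ↔ w - z ∈ W := by
      intro z
      rw [← hmem, ← Submodule.smul_mem_iff W' hc (x := ((w - z : LinearMap.ker π) : V))]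
      rw [Submodule.coe_sub, hwv, sub_sub, smul_sub, smul_inv_smul₀ hc]
    have hfv : f v = f (e + w) := by
      rw [hwv, add_sub_cancel, hf.map_smul _ (inv_ne_zero hc)]
    rw [hmem', hmem', hfv]
    have hnot : w - x ∈ W → w - y ∉ W := fun h h' => hxy (by simpa using W.sub_mem h h')
    by_cases hwx : w - x ∈ W
    · rw [if_pos hwx, if_neg (hnot hwx), sub_zero, mul_one]
      exact h1 w hwx
    · by_cases hwy : w - y ∈ W
      · rw [if_neg hwx, if_pos hwy, zero_sub, mul_neg, mul_one]
        exact h2 w hwy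
      · rw [if_neg hwx, if_neg hwy, sub_zero, mul_zero]
        exact h3 w hwx hwy

end Homogeneous

/-! ### Dictionary between vectors on points and functions on the vector space. -/

section Points

variable {p : ℕ} [Fact p.Prime]

/-- The extension of a vector indexed by the points to a function on the vector space. -/
def lift {V : Type*} [AddCommGroup V] [Module (ZMod p) V] {M : Type*} [Zero M]
    (c : ℙ (ZMod p) V → M) (v : V) : M :=
  if h : v ≠ 0 then c (Projectivization.mk _ v h) else 0

section

variable {V : Type*} [AddCommGroup V] [Module (ZMod p) V] {M : Type*}

theorem lift_zero [Zero M] (c : ℙ (ZMod p) V → M) : lift c 0 = 0 := by simp [lift]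

theorem lift_of_ne_zero [Zero M] (c : ℙ (ZMod p) V → M) {v : V} (hv : v ≠ 0) :
    lift c v = c (Projectivization.mk _ v hv) := by simp [lift, hv]

theorem lift_rep [Zero M] (c : ℙ (ZMod p) V → M) (P : ℙ (ZMod p) V) : lift c P.rep = c P := by
  rw [lift_of_ne_zero c P.rep_nonzero, P.mk_rep]

theorem lift_smul [Zero M] (c : ℙ (ZMod p) V → M) {a : ZMod p} (ha : a ≠ 0) (v : V) :
    lift c (a • v) = lift c v := by
  by_cases hv : v = 0
  · simp [hv]
  · rw [lift_of_ne_zero c hv, lift_of_ne_zero c (smul_ne_zero ha hv)]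
    congr 1
    exact (Projectivization.mk_eq_mk_iff' _ _ _ _ _).2 ⟨a, rfl⟩

theorem isPointFunction_lift (c : ℙ (ZMod p) V → ZMod p) : IsPointFunction (lift c) :=
  ⟨lift_zero c, fun _ ha v => lift_smul c ha v⟩

theorem sum_lift [Fintype V] [Fintype (ℙ (ZMod p) V)] [AddCommMonoid M] (c : ℙ (ZMod p) V → M) :
    ∑ v, lift c v = (p - 1) • ∑ P, c P := by
  rw [← add_sum_erase _ _ (mem_univ 0), lift_zero, zero_add]
  have hcard : #((univ : Finset (ZMod p)).erase 0) = p - 1 := by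
    rw [card_erase_of_mem (mem_univ _), card_univ, ZMod.card]
  rw [← hcard, ← sum_const, ← sum_product']
  symm
  refine sum_bij (fun q _ => q.1 • q.2.rep) (fun q hq => ?_) (fun q hq q' hq' h => ?_)
    (fun v hv => ?_) fun q hq => ?_
  · have hq1 : q.1 ≠ 0 := by simpa using hq
    simp [hq1, q.2.rep_nonzero]
  · have hq1 : q.1 ≠ 0 := by simpa using hq
    have hq1' : q'.1 ≠ 0 := by simpa using hq'
    have hP : q.2 = q'.2 := by
      rw [← q.2.mk_rep, ← q'.2.mk_rep, Projectivization.mk_eq_mk_iff']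
      exact ⟨q.1⁻¹ * q'.1, by rw [mul_smul, ← h, inv_smul_smul₀ hq1]⟩
    rw [hP] at h
    exact Prod.ext (smul_left_injective _ q'.2.rep_nonzero h) hP
  · have hv0 : v ≠ 0 := ne_of_mem_erase hv
    obtain ⟨a, ha⟩ := Projectivization.exists_smul_eq_mk_rep (ZMod p) v hv0
    refine ⟨((a⁻¹ : (ZMod p)ˣ), Projectivization.mk _ v hv0),
      mem_product.2 ⟨mem_erase.2 ⟨a⁻¹.ne_zero, mem_univ _⟩, mem_univ _⟩, ?_⟩
    change a⁻¹ • (Projectivization.mk _ v hv0).rep = v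
    rw [← ha, inv_smul_smul]
  · rw [lift_smul c (by simpa using hq), lift_rep]

end

variable {n : ℕ}

theorem submodule_inf (S T : Space n (ZMod p)) :
    (S ⊓ T).submodule = S.submodule ⊓ T.submodule := by
  ext v
  by_cases hv : v = 0
  · simp [hv]
  · rw [Submodule.mem_inf, Projectivization.Subspace.mem_submodule_iff _ hv,
      Projectivization.Subspace.mem_submodule_iff _ hv,
      Projectivization.Subspace.mem_submodule_iff _ hv]
    exact Iff.rfl

theorem card_supp_lift (c : Point n (ZMod p) → ZMod p) : #(supp (lift c)) = (p - 1) * wt c := by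
  have h := sum_lift (fun P => if c P ≠ 0 then 1 else 0 : Point n (ZMod p) → ℕ)
  rw [smul_eq_mul, ← card_filter] at h
  rw [wt, hammingNorm, ← h, supp, card_filter]
  refine sum_congr rfl fun v _ => ?_
  by_cases hv : v = 0
  · simp [hv, lift_zero]
  · simp [lift_of_ne_zero _ hv]

theorem lift_incVec (S : Space n (ZMod p)) {v : Fin (n + 1) → ZMod p} (hv : v ≠ 0) :
    lift (incVec p S) v = if v ∈ S.submodule then 1 else 0 := by
  rw [lift_of_ne_zero _ hv, incVec]
  simp only [Projectivization.Subspace.mem_submodule_iff S hv]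

/-- Each point of `S` is counted `p - 1 = -1` times. -/
theorem sum_mem_lift (c : Point n (ZMod p) → ZMod p) (S : Space n (ZMod p)) :
    ∑ v with v ∈ S.submodule, lift c v = -(c ⬝ᵥ incVec p S) := by
  have h := sum_lift (fun P => c P * incVec p S P)
  rw [nsmul_eq_mul, Nat.cast_sub (Fact.out : p.Prime).one_lt.le] at h
  rw [dotProduct]
  simp only [CharP.cast_eq_zero, Nat.cast_one, zero_sub, neg_mul, one_mul] at h
  rw [← h, sum_filter]
  refine sum_congr rfl fun v _ => ?_
  by_cases hv : v = 0
  · simp [hv, lift_zero]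
  · have h1 := lift_incVec S hv
    rw [lift_of_ne_zero _ hv] at h1
    rw [lift_of_ne_zero _ hv, lift_of_ne_zero _ hv, h1]
    simp

theorem mem_dual_code_iff {k : ℕ} {c : Point n (ZMod p) → ZMod p} :
    c ∈ dual (code p k n (ZMod p)) ↔ SubspaceSumsVanish (k + 1) (lift c) := by
  constructor
  · intro h W hW
    have h1 := sum_mem_lift c W.projectivization
    rw [show W.projectivization.submodule = W from
      Projectivization.Subspace.submodule.apply_symm_apply W] at h1
    rw [h1, h (incVec p W.projectivization), neg_zero]
    refine Submodule.subset_span ⟨⟨W.projectivization, ?_⟩, rfl⟩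
    rw [IsSpace, show W.projectivization.submodule = W from
      Projectivization.Subspace.submodule.apply_symm_apply W, hW]
  · intro h b hb
    induction hb using Submodule.span_induction with
    | mem b hb =>
      obtain ⟨S, rfl⟩ := hb
      have h1 := sum_mem_lift c S.1
      rw [h _ S.2, eq_comm, neg_eq_zero] at h1
      exact h1
    | zero => exact dotProduct_zero c
    | add x y _ _ hx hy => rw [dotProduct_add, hx, hy, add_zero]
    | smul r x _ hx => rw [dotProduct_smul, hx, smul_zero]

theorem eq_smul_sub_iff {c : Point n (ZMod p) → ZMod p} {a : ZMod p} {S T : Space n (ZMod p)} :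
    c = a • (incVec p S - incVec p T) ↔ ∀ v, lift c v =
      a * ((if v ∈ S.submodule then 1 else 0) - if v ∈ T.submodule then 1 else 0) := by
  constructor
  · rintro rfl v
    by_cases hv : v = 0
    · simp [hv, lift_zero]
    · rw [← lift_incVec S hv, ← lift_incVec T hv]
      simp [lift_of_ne_zero _ hv]
  · intro h
    ext P
    rw [← lift_rep c P, h, ← lift_incVec S P.rep_nonzero, ← lift_incVec T P.rep_nonzero, lift_rep,
      lift_rep]
    rfl

end Points

/-! ### Differences of two subspaces attain the bound. -/

section Differences

variable {p : ℕ} [Fact p.Prime] {V : Type*} [AddCommGroup V] [Module (ZMod p) V] [Fintype V]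

theorem card_mem {d : ℕ} {W : Submodule (ZMod p) V} (hW : finrank (ZMod p) W = d) :
    #{v | v ∈ W} = p ^ d := by
  simpa using card_flat hW 0

/-- By the dimension formula an `m`-dimensional subspace meets `S` and `T` non-trivially, hence in a
multiple of `p` vectors. -/
theorem subspaceSumsVanish_of_eq {m s : ℕ} {f : V → ZMod p} {a : ZMod p}
    {S T : Submodule (ZMod p) V} (hS : finrank (ZMod p) S = s) (hT : finrank (ZMod p) T = s)
    (hms : finrank (ZMod p) V < m + s)
    (hf : ∀ v, f v = a * ((if v ∈ S then 1 else 0) - if v ∈ T then 1 else 0)) :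
    SubspaceSumsVanish m f := by
  intro W hW
  have key : ∀ U : Submodule (ZMod p) V, finrank (ZMod p) U = s →
      ∑ v with v ∈ W, (if v ∈ U then 1 else 0 : ZMod p) = 0 := by
    intro U hU
    have h1 := Submodule.finrank_sup_add_finrank_inf_eq W U
    have h2 := Submodule.finrank_le (W ⊔ U)
    obtain ⟨j, hj⟩ : ∃ j, finrank (ZMod p) (W ⊓ U : Submodule (ZMod p) V) = j + 1 :=
      Nat.exists_eq_add_of_le' (by omega)
    rw [sum_boole, filter_filter]
    have h3 := card_mem hj
    simp only [Submodule.mem_inf] at h3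
    rw [h3, pow_succ]
    simp
  simp_rw [hf]
  rw [← mul_sum, sum_sub_distrib, key S hS, key T hT, sub_zero, mul_zero]

theorem card_supp_of_eq {d : ℕ} {f : V → ZMod p} {a : ZMod p} (ha : a ≠ 0)
    {S T : Submodule (ZMod p) V} (hS : finrank (ZMod p) S = d + 1)
    (hT : finrank (ZMod p) T = d + 1)
    (hST : finrank (ZMod p) (S ⊓ T : Submodule (ZMod p) V) = d)
    (hf : ∀ v, f v = a * ((if v ∈ S then 1 else 0) - if v ∈ T then 1 else 0)) :
    #(supp f) = (p - 1) * (2 * p ^ d) := by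
  have hcS := card_mem hS
  have hcT := card_mem hT
  have hcI := card_mem hST
  have hinter : ({v | v ∈ S} : Finset V) ∩ ({v | v ∈ T} : Finset V) =
      ({v | v ∈ S ⊓ T} : Finset V) := by
    ext v; simp
  have hsupp : supp f = (({v | v ∈ S} : Finset V) \ ({v | v ∈ T} : Finset V)) ∪
      (({v | v ∈ T} : Finset V) \ ({v | v ∈ S} : Finset V)) := by
    ext v
    by_cases h1 : v ∈ S <;> by_cases h2 : v ∈ T <;> simp [hf, h1, h2, ha]
  rw [hsupp, card_union_of_disjoint (disjoint_sdiff_sdiff)]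
  have h1 := card_sdiff_add_card_inter ({v | v ∈ S} : Finset V) ({v | v ∈ T} : Finset V)
  have h2 := card_sdiff_add_card_inter ({v | v ∈ T} : Finset V) ({v | v ∈ S} : Finset V)
  rw [inter_comm] at h2
  rw [hinter, hcI, hcS, pow_succ] at h1
  rw [hinter, hcI, hcT, pow_succ] at h2
  have h3 : (p - 1) * (2 * p ^ d) + 2 * p ^ d = 2 * (p ^ d * p) := by
    obtain ⟨q, hq⟩ := Nat.exists_eq_add_of_le' (Fact.out : p.Prime).one_lt.le
    have h4 : p - 1 = q := by omega
    rw [h4]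
    nlinarith
  omega

theorem finrank_span_singleton_sup_of_notMem {W : Submodule (ZMod p) V} {v : V} (hv : v ∉ W) :
    finrank (ZMod p) (Submodule.span (ZMod p) {v} ⊔ W : Submodule (ZMod p) V) =
      finrank (ZMod p) W + 1 := by
  have hv0 : v ≠ 0 := by rintro rfl; exact hv W.zero_mem
  have h1 := Submodule.finrank_add_le_finrank_add_finrank (Submodule.span (ZMod p) {v}) W
  rw [finrank_span_singleton hv0] at h1
  have h2 : W < Submodule.span (ZMod p) {v} ⊔ W := lt_of_le_of_ne le_sup_right fun h => hv (by
    rw [h]; exact Submodule.mem_sup_left (Submodule.mem_span_singleton_self v))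
  have := Submodule.finrank_lt_finrank_of_lt h2
  omega

theorem exists_notMem_of_finrank_lt {W : Submodule (ZMod p) V}
    (h : finrank (ZMod p) W < finrank (ZMod p) V) : ∃ v, v ∉ W := by
  by_contra! hall
  rw [(Submodule.eq_top_iff' (p := W)).2 hall, finrank_top] at h
  exact lt_irrefl _ h

theorem exists_submodule_finrank_eq {m : ℕ} (h : m ≤ finrank (ZMod p) V) :
    ∃ W : Submodule (ZMod p) V, finrank (ZMod p) W = m := by
  induction m with
  | zero => exact ⟨⊥, finrank_bot _ _⟩
  | succ m ih =>
    obtain ⟨W, hW⟩ := ih (by omega)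
    obtain ⟨v, hv⟩ := exists_notMem_of_finrank_lt (W := W) (by omega)
    exact ⟨_, by rw [finrank_span_singleton_sup_of_notMem hv, hW]⟩

theorem exists_subspaces_inter {m : ℕ} (h : m + 2 ≤ finrank (ZMod p) V) :
    ∃ S T : Submodule (ZMod p) V, finrank (ZMod p) S = m + 1 ∧ finrank (ZMod p) T = m + 1 ∧
      finrank (ZMod p) (S ⊓ T : Submodule (ZMod p) V) = m := by
  obtain ⟨W, hW⟩ := exists_submodule_finrank_eq (p := p) (V := V) (m := m) (by omega)
  obtain ⟨v, hv⟩ := exists_notMem_of_finrank_lt (W := W) (by omega)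
  have hS := finrank_span_singleton_sup_of_notMem hv
  obtain ⟨u, hu⟩ := exists_notMem_of_finrank_lt (W := Submodule.span (ZMod p) {v} ⊔ W) (by omega)
  have hT := finrank_span_singleton_sup_of_notMem (W := W) (v := u)
    fun h => hu (Submodule.mem_sup_right h)
  refine ⟨_, _, by rw [hS, hW], by rw [hT, hW], ?_⟩
  have hlt : (Submodule.span (ZMod p) {v} ⊔ W) ⊓ (Submodule.span (ZMod p) {u} ⊔ W) <
      Submodule.span (ZMod p) {u} ⊔ W := lt_of_le_of_ne inf_le_right fun h =>
    hu (inf_eq_right.1 h (Submodule.mem_sup_left (Submodule.mem_span_singleton_self u)))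
  have h1 := Submodule.finrank_lt_finrank_of_lt hlt
  have h2 : W ≤ (Submodule.span (ZMod p) {v} ⊔ W) ⊓ (Submodule.span (ZMod p) {u} ⊔ W) :=
    le_inf le_sup_right le_sup_right
  have h3 := Submodule.finrank_mono h2
  omega

end Differences

end ProjCode

end

theorem mainTheorem8 (p : ℕ) [Fact p.Prime] (n k : ℕ) (hk : 0 < k) (hkn : k ≤ n - 1) :
    ProjCode.IsMinWeight (ProjCode.dual (ProjCode.code p k n (ZMod p))) (2 * p ^ (n - k)) ∧
    ∀ c : ProjCode.Point n (ZMod p) → ZMod p,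
      (c ∈ ProjCode.dual (ProjCode.code p k n (ZMod p)) ∧ ProjCode.wt c = 2 * p ^ (n - k)) ↔
        ∃ (a : ZMod p) (S T : ProjCode.Space n (ZMod p)),
          a ≠ 0 ∧ ProjCode.IsSpace (n - k) S ∧ ProjCode.IsSpace (n - k) T ∧
          ProjCode.IsSpace (n - k - 1) (S ⊓ T) ∧
          c = a • (ProjCode.incVec p S - ProjCode.incVec p T) := by
  obtain ⟨k, rfl⟩ : ∃ j, k = j + 1 := Nat.exists_eq_add_of_le' hk
  -- With `k` already lowered by one, the exponent `n - k` of the statement is `d + 1`; it is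
  -- positive, as the equality case of `IsPointFunction.bound` requires.
  obtain ⟨d, rfl⟩ : ∃ d, n = d + k + 2 := ⟨n - k - 2, by omega⟩
  rw [show d + k + 2 - (k + 1) = d + 1 by omega, Nat.add_sub_cancel]
  have hp : p.Prime := Fact.out
  have hp1 : 0 < p - 1 := Nat.sub_pos_of_lt hp.one_lt
  have hV : Module.finrank (ZMod p) (Fin (d + k + 2 + 1) → ZMod p) = d + 1 + k + 2 := by
    rw [Module.finrank_fin_fun]; omega
  have hsub : ∀ W : Submodule (ZMod p) (Fin (d + k + 2 + 1) → ZMod p),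
      Projectivization.Subspace.submodule W.projectivization = W :=
    Projectivization.Subspace.submodule.apply_symm_apply
  have hiff : ∀ c : ProjCode.Point (d + k + 2) (ZMod p) → ZMod p,
      (c ∈ ProjCode.dual (ProjCode.code p (k + 1) (d + k + 2) (ZMod p)) ∧
        ProjCode.wt c = 2 * p ^ (d + 1)) ↔
        ∃ (a : ZMod p) (S T : ProjCode.Space (d + k + 2) (ZMod p)),
          a ≠ 0 ∧ ProjCode.IsSpace (d + 1) S ∧ ProjCode.IsSpace (d + 1) T ∧
          ProjCode.IsSpace d (S ⊓ T) ∧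
          c = a • (ProjCode.incVec p S - ProjCode.incVec p T) := by
    intro c
    rw [ProjCode.mem_dual_code_iff]
    constructor
    · rintro ⟨hc, hwt⟩
      obtain ⟨S, T, a, ha, hS, hT, hST, h⟩ := (ProjCode.isPointFunction_lift c).exists_subspaces
        hV hc (by rw [ProjCode.card_supp_lift, hwt])
      refine ⟨a, S.projectivization, T.projectivization, ha, ?_, ?_, ?_,
        ProjCode.eq_smul_sub_iff.2 ?_⟩
      · rw [ProjCode.IsSpace, hsub, hS]
      · rw [ProjCode.IsSpace, hsub, hT]
      · rw [ProjCode.IsSpace, ProjCode.submodule_inf, hsub, hsub, hST]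
      · rwa [hsub, hsub]
    · rintro ⟨a, S, T, ha, hS, hT, hST, h⟩
      rw [ProjCode.eq_smul_sub_iff] at h
      rw [ProjCode.IsSpace, ProjCode.submodule_inf] at hST
      refine ⟨ProjCode.subspaceSumsVanish_of_eq hS hT (by omega) h, ?_⟩
      refine Nat.eq_of_mul_eq_mul_left hp1 ?_
      rw [← ProjCode.card_supp_lift, ProjCode.card_supp_of_eq ha hS hT hST h]
  refine ⟨⟨?_, ?_⟩, hiff⟩
  · obtain ⟨S, T, hS, hT, hST⟩ := ProjCode.exists_subspaces_inter (p := p)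
      (V := Fin (d + k + 2 + 1) → ZMod p) (m := d + 1) (by omega)
    have h := (hiff ((1 : ZMod p) • (ProjCode.incVec p S.projectivization -
      ProjCode.incVec p T.projectivization))).2 ⟨1, S.projectivization, T.projectivization,
        one_ne_zero, by rw [ProjCode.IsSpace, hsub, hS], by rw [ProjCode.IsSpace, hsub, hT],
        by rw [ProjCode.IsSpace, ProjCode.submodule_inf, hsub, hsub, hST], rfl⟩
    refine ⟨_, h.1, fun h0 => ?_, h.2⟩
    have h1 := h.2
    rw [h0, ProjCode.wt, hammingNorm_zero] at h1
    have : 0 < p ^ (d + 1) := Nat.pow_pos hp.pos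
    omega
  · rintro w ⟨c, hc, hc0, rfl⟩
    rw [ProjCode.mem_dual_code_iff] at hc
    obtain ⟨P, hP⟩ := Function.ne_iff.1 hc0
    have h := ((ProjCode.isPointFunction_lift c).bound hV hc
      ⟨P.rep, by rwa [ProjCode.lift_rep]⟩).1
    rw [ProjCode.card_supp_lift] at h
    exact Nat.le_of_mul_le_mul_left h hp1
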